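/- **Setting.** Let $k$ be a field and $N\hookrightarrow M$ an extension of (unital associative) $k$-algebras. Suppose given an $N$-bimodule map $E:M\to N$ with $E(1)=1$, a scalar $\lambda\in k\setminus\{0\}$ and elements $x_i,y_i\in M$ ($i=1,\dots,r$) with $$\sum_i E(mx_i)y_i=m=\sum_i x_iE(y_im)\quad(m\in M),\qquad \sum_i x_iy_i=\lambda^{-1}1,$$ and a trace $T:N\to k$ with $T(1)=1$ such that $T_0:=T\circ E$ is a trace on $M$. Let $U=C_M(N)$ be the centralizer of $N$ in $M$, and suppose $E(um)=E(mu)$ for all $u\in U$, $m\in M$. Let $M_1=\mathrm{End}(M_N)\cong M\otimes_N M$ be the basic construction: $M\subset M_1$ by left multiplications, $e_1=E\in M_1$, so that $M_1=Me_1M$, and $E_M:M_1\to M$ is given by $E_M(me_1m')=\lambda mm'$. Then $M_1/M$, with $E_M$, the dual bases $\lambda^{-1}x_ie_1,\ e_1y_i$ and the same $\lambda$, is an extension of the same kind. Iterate once to get $M_2=\mathrm{End}((M_1)_M)=M_1e_2M_1$ with $E_{M_1}(xe_2y)=\lambda xy$ for $x,y\in M_1$. Put $T_1=T_0\circ E_M$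 and $T_2=T_1\circ E_{M_1}$, and $$V=C_{M_1}(M),\qquad A=C_{M_1}(N),\qquad B=C_{M_2}(M).$$ A *symmetric separability element* of a $k$-algebra $R$ is an $f=f^{(1)}\otimes f^{(2)}\in R\otimes_k R$ with $f^{(1)}f^{(2)}=1$, $rf^{(1)}\otimes f^{(2)}=f^{(1)}\otimes f^{(2)}r$ for all $r\in R$, and $f^{(1)}\otimes f^{(2)}=f^{(2)}\otimes f^{(1)}$; $R$ is *Kanzaki separable* if it has one. Assume: 1. (symmetric product) $\sum_i y_ix_i=\lambda^{-1}1$; or, alternatively, $T_1\big(\sum_i x_iue_1y_i\big)=T_0(u)$ for all $u\in U$; 2. (weak irreducibility) $U$ is Kanzaki separable and the trace $T_0|_U$ is nondegenerate; 3. (depth 2) $E_M$ has dual bases lying in $A$, and $E_{M_1}$ has dual bases lying in $B$; that is, there are finitely many $z_j,w_j\in A$ with $\sum_jE_M(xz_j)w_j=x=\sum_jz_jE_M(w_jx)$ for all $x\in M_1$, and likewise finitely many $u_j,v_j\in B$ for $E_{M_1}$ on $M_2$. A *weak Hopf algebra* over $k$ is a $k$-vector space $H$ that is an algebra and a coalgebra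 $(H,\Delta,\varepsilon)$, with a linear map $S:H\to H$, such that for all $h,g,f\in H$ (Sweedler notation) $\Delta(hg)=\Delta(h)\Delta(g)$; $\varepsilon(hgf)=\varepsilon(hg_{(1)})\varepsilon(g_{(2)}f)=\varepsilon(hg_{(2)})\varepsilon(g_{(1)}f)$; $(\Delta\otimes\mathrm{id})\Delta(1)=(\Delta(1)\otimes1)(1\otimes\Delta(1))=(1\otimes\Delta(1))(\Delta(1)\otimes1)$; $h_{(1)}S(h_{(2)})=(\varepsilon\otimes\mathrm{id})(\Delta(1)(h\otimes1))$; $S(h_{(1)})h_{(2)}=(\mathrm{id}\otimes\varepsilon)((1\otimes h)\Delta(1))$; and $S(h_{(1)})h_{(2)}S(h_{(3)})=S(h)$. **Theorem.** Under these assumptions $V$ has a unique symmetric separability element $f=f^{(1)}\otimes f^{(2)}$; the element $f^{(1)}T_1(f^{(2)})$ of $V$ is invertible, and its inverse $w$ is central in $V$ and satisfies $f^{(1)}T_1(vwf^{(2)})=v$ for all $v\in V$. The bilinear forms on $A\times B$ $$\langle a,b\rangle=\lambda^{-2}T_2(ae_2e_1wb),\qquad \langle a,b\rangle'=\lambda^{-2}T_2(be_1e_2wa)$$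 are nondegenerate. There are unique linear maps $\Delta:B\to B\otimes_kB$, $\varepsilon:B\to k$ and $S:B\to B$ such that, for all $a,a'\in A$ and $b\in B$, $$\langle a,b_{(1)}\rangle\langle a',b_{(2)}\rangle=\langle aa',b\rangle,\qquad \varepsilon(b)=\langle1,b\rangle,\qquad \langle a,S(b)\rangle'=\langle a,b\rangle,$$ where $\Delta(b)=b_{(1)}\otimes b_{(2)}$. The map $S$ is bijective, and $(B,\Delta,\varepsilon,S)$ is a weak Hopf algebra with comultiplication $\Delta$, counit $\varepsilon$ and antipode $S$, whose underlying algebra $B$ is semisimple. -/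

import Mathlib

open scoped TensorProduct

/-! ### Weak Hopf algebras -/

/-- A weak Hopf algebra over a field `k`: an algebra and a coalgebra `H` with a linear map
`antipode : H → H` satisfying the axioms below. -/
class WeakHopfAlgebra (k H : Type*) [Field k] [Ring H] [Algebra k H] extends Coalgebra k H where
  /-- The antipode. -/
  antipode : H →ₗ[k] H
  /-- `Δ(h g) = Δ(h) Δ(g)` -/
  comul_mul : ∀ h g : H, comul (h * g) = comul h * comul g
  /-- `ε(h g f) = ε(h g₁) ε(g₂ f)` -/
  counit_mul_mul : ∀ h g f : H, counit (h * g * f) =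
    LinearMap.mul' k k (TensorProduct.map (counit ∘ₗ LinearMap.mulLeft k h)
      (counit ∘ₗ LinearMap.mulRight k f) (comul g))
  /-- `ε(h g f) = ε(h g₂) ε(g₁ f)` -/
  counit_mul_mul' : ∀ h g f : H, counit (h * g * f) =
    LinearMap.mul' k k (TensorProduct.map (counit ∘ₗ LinearMap.mulRight k f)
      (counit ∘ₗ LinearMap.mulLeft k h) (comul g))
  /-- `(Δ ⊗ id) Δ(1) = (Δ(1) ⊗ 1) (1 ⊗ Δ(1))` -/
  comul_comul_one : comul.rTensor H (comul (1 : H)) =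
    (comul (1 : H) ⊗ₜ[k] (1 : H)) *
      (TensorProduct.assoc k H H H).symm ((1 : H) ⊗ₜ[k] comul (1 : H))
  /-- `(Δ ⊗ id) Δ(1) = (1 ⊗ Δ(1)) (Δ(1) ⊗ 1)` -/
  comul_comul_one' : comul.rTensor H (comul (1 : H)) =
    (TensorProduct.assoc k H H H).symm ((1 : H) ⊗ₜ[k] comul (1 : H)) *
      (comul (1 : H) ⊗ₜ[k] (1 : H))
  /-- `h₁ S(h₂) = (ε ⊗ id) (Δ(1) (h ⊗ 1))` -/
  mul_antipode : ∀ h : H, LinearMap.mul' k H (antipode.lTensor H (comul h)) =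
    TensorProduct.lid k H (counit.rTensor H (comul (1 : H) * (h ⊗ₜ[k] (1 : H))))
  /-- `S(h₁) h₂ = (id ⊗ ε) ((1 ⊗ h) Δ(1))` -/
  antipode_mul : ∀ h : H, LinearMap.mul' k H (antipode.rTensor H (comul h)) =
    TensorProduct.rid k H (counit.lTensor H (((1 : H) ⊗ₜ[k] h) * comul (1 : H)))
  /-- `S(h₁) h₂ S(h₃) = S(h)` -/
  antipode_mul_antipode : ∀ h : H,
    LinearMap.mul' k H (TensorProduct.map (LinearMap.mul' k H ∘ₗ antipode.rTensor H) antipode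
      (comul.rTensor H (comul h))) = antipode h

/-! ### Kanzaki separable algebras -/

/-- `f = f₁ ⊗ f₂ ∈ R ⊗ R` is a symmetric separability element of the `k`-algebra `R`:
`f₁ f₂ = 1`, `r f₁ ⊗ f₂ = f₁ ⊗ f₂ r` for all `r ∈ R`, and `f₁ ⊗ f₂ = f₂ ⊗ f₁`. -/
structure IsSymmetricSeparabilityElement (k : Type*) {R : Type*} [Field k] [Ring R] [Algebra k R]
    (f : R ⊗[k] R) : Prop where
  mul_eq_one : LinearMap.mul' k R f = 1
  casimir : ∀ r : R, (r ⊗ₜ[k] (1 : R)) * f = f * ((1 : R) ⊗ₜ[k] r)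
  symm : TensorProduct.comm k R R f = f

/-- A `k`-algebra is Kanzaki separable if it has a symmetric separability element. -/
def IsKanzakiSeparable (k R : Type*) [Field k] [Ring R] [Algebra k R] : Prop :=
  ∃ f : R ⊗[k] R, IsSymmetricSeparabilityElement k f

/-! ### Strongly separable extensions and the basic construction -/

/-- A strongly separable extension structure on the extension `ι : N → M` of `k`-algebras
(`ι` is injective because of `E_mul_right` and `E_one`): a Frobenius homomorphism `E` with dual
bases `x i`, `y i` such that `E 1 = 1` and `∑ x i * y i = λ⁻¹ 1`, with `λ ∈ k` nonzero. -/
structure StronglySeparable (k : Type*) {N M : Type*} [Field k] [Ring N] [Ring M]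
    [Algebra k N] [Algebra k M] (ι : N →ₐ[k] M) where
  E : M →ₗ[k] N
  E_mul_left : ∀ (n : N) (m : M), E (ι n * m) = n * E m
  E_mul_right : ∀ (m : M) (n : N), E (m * ι n) = E m * n
  r : ℕ
  x : Fin r → M
  y : Fin r → M
  dual_left : ∀ m : M, ∑ i, ι (E (m * x i)) * y i = m
  dual_right : ∀ m : M, ∑ i, x i * ι (E (y i * m)) = m
  E_one : E 1 = 1
  lam : k
  lam_ne_zero : lam ≠ 0
  sum_x_mul_y : ∑ i, x i * y i = lam⁻¹ • (1 : M)

section BasicConstruction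

variable {k N M : Type*} [Field k] [Ring N] [Ring M] [Algebra k N] [Algebra k M]

/-- The endomorphisms of `M` as a right `N`-module, as a subalgebra of `End_k(M)`. -/
def rightEnd (ι : N →ₐ[k] M) : Subalgebra k (Module.End k M) where
  carrier := {f | ∀ (m : M) (n : N), f (m * ι n) = f m * ι n}
  mul_mem' := by
    intro f g hf hg m n
    rw [Module.End.mul_apply, Module.End.mul_apply, hg, hf]
  add_mem' := by
    intro f g hf hg m n
    rw [LinearMap.add_apply, LinearMap.add_apply, hf, hg, add_mul]
  algebraMap_mem' := by
    intro c m n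
    simp [Module.algebraMap_end_apply]

/-- The algebra `End(M_N)` of endomorphisms of `M` as a right `N`-module. It is the basic
construction `M₁ = M e₁ M ≅ M ⊗_N M` of a strongly separable extension `M / N`. -/
def BasicConstruction (ι : N →ₐ[k] M) : Type _ := ↥(rightEnd ι)

namespace BasicConstruction

variable (ι : N →ₐ[k] M)

instance : Ring (BasicConstruction ι) := inferInstanceAs (Ring ↥(rightEnd ι))

instance : Algebra k (BasicConstruction ι) := inferInstanceAs (Algebra k ↥(rightEnd ι))

/-- The inclusion of `End(M_N)` into `End_k(M)`. -/
def val : BasicConstruction ι →ₐ[k] Module.End k M := (rightEnd ι).val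

instance : FunLike (BasicConstruction ι) M M where
  coe f := val ι f
  coe_injective _ _ h := Subtype.ext (LinearMap.ext (congrFun h))

/-- The inclusion `M → M₁`, sending `m` to the left multiplication by `m`. -/
def incl : M →ₐ[k] BasicConstruction ι :=
  (Algebra.lmul k M).codRestrict (rightEnd ι) (fun m m' n => by
    simp [mul_assoc])

variable {ι}

theorem ext {f g : BasicConstruction ι} (h : ∀ m, f m = g m) : f = g := DFunLike.ext _ _ h

theorem apply_mul (f : BasicConstruction ι) (m : M) (n : N) : f (m * ι n) = f m * ι n := f.2 m n

@[simp] theorem incl_apply (m m' : M) : incl ι m m' = m * m' := rfl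

@[simp] theorem mul_apply (f g : BasicConstruction ι) (m : M) : (f * g) m = f (g m) := rfl

@[simp] theorem one_apply (m : M) : (1 : BasicConstruction ι) m = m := rfl

@[simp] theorem add_apply (f g : BasicConstruction ι) (m : M) : (f + g) m = f m + g m := rfl

@[simp] theorem smul_apply (c : k) (f : BasicConstruction ι) (m : M) : (c • f) m = c • f m := rfl

theorem map_sum_apply {s : ℕ} (f : BasicConstruction ι) (g : Fin s → M) :
    f (∑ i, g i) = ∑ i, f (g i) := map_sum (val ι f) g _

theorem sum_apply {s : ℕ} (f : Fin s → BasicConstruction ι) (m : M) :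
    (∑ i, f i) m = ∑ i, f i m := by
  change (val ι (∑ i, f i)) m = _
  rw [map_sum, LinearMap.sum_apply]
  rfl

end BasicConstruction

namespace StronglySeparable

open BasicConstruction (incl)

variable {ι : N →ₐ[k] M} (D : StronglySeparable k ι)

/-- The Jones idempotent `e₁ ∈ M₁`: the map `E`, viewed as an endomorphism of `M_N`. -/
def jones : BasicConstruction ι :=
  ⟨ι.toLinearMap ∘ₗ D.E, fun m n => by simp [D.E_mul_right]⟩

@[simp] theorem jones_apply (m : M) : D.jones m = ι (D.E m) := rfl

/-- The conditional expectation `E_M : M₁ → M`, `E_M(f) = λ ∑ f(x i) y i`; it is determined by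
`E_M(m e₁ m') = λ m m'`, see `condExp_mul_jones_mul` and `eq_sum_jones`. -/
def condExp : BasicConstruction ι →ₗ[k] M where
  toFun f := D.lam • ∑ i, f (D.x i) * D.y i
  map_add' f g := by simp [add_mul, Finset.sum_add_distrib]
  map_smul' c f := by
    simp only [BasicConstruction.smul_apply, smul_mul_assoc, ← Finset.smul_sum, RingHom.id_apply]
    exact smul_comm _ _ _

theorem condExp_apply (f : BasicConstruction ι) :
    D.condExp f = D.lam • ∑ i, f (D.x i) * D.y i := rfl

theorem eq_sum_jones (f : BasicConstruction ι) :
    f = ∑ i, incl ι (f (D.x i)) * D.jones * incl ι (D.y i) := by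
  apply BasicConstruction.ext
  intro m
  conv_lhs => rw [← D.dual_right m]
  simp [BasicConstruction.apply_mul, BasicConstruction.sum_apply,
    BasicConstruction.map_sum_apply]

theorem condExp_mul_jones_mul (m m' : M) :
    D.condExp (incl ι m * D.jones * incl ι m') = D.lam • (m * m') := by
  rw [condExp_apply]
  congr 1
  conv_rhs => rw [← D.dual_left m']
  simp [Finset.mul_sum, mul_assoc]

theorem jones_mul_incl_mul_jones (m : M) :
    D.jones * incl ι m * D.jones = D.jones * incl ι (ι (D.E m)) := by
  apply BasicConstruction.ext
  intro m'
  simp [D.E_mul_left, D.E_mul_right]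

theorem jones_mul_jones : D.jones * D.jones = D.jones := by
  simpa [D.E_one] using D.jones_mul_incl_mul_jones 1

theorem condExp_mul_left (m : M) (f : BasicConstruction ι) :
    D.condExp (incl ι m * f) = m * D.condExp f := by
  simp [condExp_apply, Finset.mul_sum, mul_assoc]

theorem condExp_mul_right (f : BasicConstruction ι) (m : M) :
    D.condExp (f * incl ι m) = D.condExp f * m := by
  conv_lhs => rw [D.eq_sum_jones f]
  rw [Finset.sum_mul, map_sum, condExp_apply, smul_mul_assoc, Finset.sum_mul, Finset.smul_sum]
  refine Finset.sum_congr rfl fun i _ => ?_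
  rw [mul_assoc, ← map_mul, condExp_mul_jones_mul, mul_assoc]

/-- The basic construction of a strongly separable extension `M / N`: the extension `M₁ / M` with
conditional expectation `E_M`, dual bases `λ⁻¹ x i e₁`, `e₁ y i`, and the same `λ`. -/
def next : StronglySeparable k (incl ι) where
  E := D.condExp
  E_mul_left := D.condExp_mul_left
  E_mul_right := D.condExp_mul_right
  r := D.r
  x i := D.lam⁻¹ • (incl ι (D.x i) * D.jones)
  y i := D.jones * incl ι (D.y i)
  dual_left f := by
    conv_rhs => rw [D.eq_sum_jones f]
    refine Finset.sum_congr rfl fun i _ => ?_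
    have h : D.condExp (f * (D.lam⁻¹ • (incl ι (D.x i) * D.jones))) = f (D.x i) := by
      rw [mul_smul_comm, map_smul, condExp_apply, smul_smul, inv_mul_cancel₀ D.lam_ne_zero,
        one_smul]
      simp only [BasicConstruction.mul_apply, jones_apply, BasicConstruction.incl_apply,
        BasicConstruction.apply_mul, mul_assoc, ← Finset.mul_sum]
      rw [show ∑ j, ι (D.E (D.x j)) * D.y j = 1 by simpa using D.dual_left 1, mul_one]
    rw [h, mul_assoc]
  dual_right f := by
    have h (i : Fin D.r) : D.condExp (D.jones * incl ι (D.y i) * f) =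
        D.lam • ∑ j, ι (D.E (D.y i * f (D.x j))) * D.y j := by
      rw [condExp_apply]
      simp
    apply BasicConstruction.ext
    intro m
    conv_rhs => rw [← D.dual_right (f m)]
    rw [BasicConstruction.sum_apply]
    refine Finset.sum_congr rfl fun i _ => ?_
    rw [h, map_smul, mul_smul_comm, smul_mul_assoc, smul_smul, mul_inv_cancel₀ D.lam_ne_zero,
      one_smul]
    simp only [BasicConstruction.mul_apply, BasicConstruction.incl_apply, jones_apply]
    have h' : D.E (D.y i * f m) =
        D.E ((∑ j, ι (D.E (D.y i * f (D.x j))) * D.y j) * m) := by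
      conv_lhs => rw [← D.dual_right m]
      rw [BasicConstruction.map_sum_apply, Finset.mul_sum, Finset.sum_mul, map_sum, map_sum]
      refine Finset.sum_congr rfl fun j _ => ?_
      rw [BasicConstruction.apply_mul, ← mul_assoc, D.E_mul_right, mul_assoc, D.E_mul_left]
    rw [h']
  E_one := by
    rw [condExp_apply]
    simp [D.sum_x_mul_y, smul_smul, D.lam_ne_zero]
  lam := D.lam
  lam_ne_zero := D.lam_ne_zero
  sum_x_mul_y := by
    simp only [smul_mul_assoc, ← Finset.smul_sum]
    congr 1
    conv_rhs => rw [D.eq_sum_jones 1]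
    refine Finset.sum_congr rfl fun i _ => ?_
    rw [mul_assoc, ← mul_assoc D.jones, D.jones_mul_jones, ← mul_assoc]
    simp

/-! ### Hypotheses on the extension -/

/-- `T : N → k` is a Markov trace for the extension, and the extension is symmetric:
`T` is a trace with `T 1 = 1`, `T₀ = T ∘ E` is a trace on `M`, and `E(u x) = E(x u)` for `u` in
the centralizer `U = C_M(N)`. -/
structure IsSymmetricMarkov (T : N →ₗ[k] k) : Prop where
  trace : ∀ n n' : N, T (n * n') = T (n' * n)
  one : T 1 = 1
  trace_E : ∀ m m' : M, T (D.E (m * m')) = T (D.E (m' * m))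
  symmetric : ∀ u ∈ Subalgebra.centralizer k (Set.range ι), ∀ m : M, D.E (u * m) = D.E (m * u)

/-- The extension has dual bases in `S` for its conditional expectation. -/
def HasDualBasesIn (S : Subalgebra k M) : Prop :=
  ∃ (s : ℕ) (z w : Fin s → M), (∀ i, z i ∈ S) ∧ (∀ i, w i ∈ S) ∧
    (∀ m : M, ∑ i, ι (D.E (m * z i)) * w i = m) ∧ (∀ m : M, ∑ i, z i * ι (D.E (w i * m)) = m)

/-! ### The Jones tower `N ⊆ M ⊆ M₁ ⊆ M₂` and its centralizers -/

/-- The algebra `M₁`. -/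
abbrev M₁ (_ : StronglySeparable k ι) : Type _ := BasicConstruction ι

/-- The algebra `M₂`, the basic construction of `M₁ / M`. -/
abbrev M₂ (_ : StronglySeparable k ι) : Type _ := BasicConstruction (incl ι)

/-- The inclusion `M → M₁`. -/
abbrev ι₁ : M →ₐ[k] D.M₁ := incl ι

/-- The inclusion `M₁ → M₂`. -/
abbrev ι₂ : D.M₁ →ₐ[k] D.M₂ := incl (incl ι)

/-- `e₁ ∈ M₁` -/
abbrev e₁ : D.M₁ := D.jones

/-- `e₂ ∈ M₂` -/
abbrev e₂ : D.M₂ := D.next.jones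

/-- `T₀ = T ∘ E : M → k` -/
def T₀ (T : N →ₗ[k] k) : M →ₗ[k] k := T ∘ₗ D.E

/-- `T₁ = T ∘ E ∘ E_M : M₁ → k` -/
def T₁ (T : N →ₗ[k] k) : D.M₁ →ₗ[k] k := D.T₀ T ∘ₗ D.next.E

/-- `T₂ = T ∘ E ∘ E_M ∘ E_{M₁} : M₂ → k` -/
def T₂ (T : N →ₗ[k] k) : D.M₂ →ₗ[k] k := D.T₁ T ∘ₗ D.next.next.E

/-- `U = C_M(N)` -/
abbrev U (_ : StronglySeparable k ι) : Subalgebra k M := Subalgebra.centralizer k (Set.range ι)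

/-- `V = C_{M₁}(M)` -/
abbrev V : Subalgebra k D.M₁ := Subalgebra.centralizer k (Set.range D.ι₁)

/-- `A = C_{M₁}(N)` -/
abbrev A : Subalgebra k D.M₁ := Subalgebra.centralizer k (Set.range (D.ι₁.comp ι))

/-- `B = C_{M₂}(M)` -/
abbrev B : Subalgebra k D.M₂ := Subalgebra.centralizer k (Set.range (D.ι₂.comp D.ι₁))

/-- Weak irreducibility: `U` is Kanzaki separable and the trace `T₀` is nondegenerate on `U`. -/
def WeaklyIrreducible (T : N →ₗ[k] k) : Prop :=
  IsKanzakiSeparable k D.U ∧ ∀ u ∈ D.U, (∀ u' ∈ D.U, D.T₀ T (u * u') = 0) → u = 0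

/-- The symmetric product condition `∑ y i * x i = λ⁻¹ 1` (`∑ x i * y i = λ⁻¹ 1` always holds). -/
def SymmetricProduct : Prop := ∑ i, D.y i * D.x i = D.lam⁻¹ • (1 : M)

/-- The map `φ : U → V`, `φ(u) = ∑ x i u e₁ y i`, as a map on `M` with values in `M₁`. -/
def phi (u : M) : D.M₁ := ∑ i, D.ι₁ (D.x i * u) * D.e₁ * D.ι₁ (D.y i)

/-- The depth 2 condition: `E_M` has dual bases in `A` and `E_{M₁}` has dual bases in `B`. -/
def DepthTwo : Prop := D.next.HasDualBasesIn D.A ∧ D.next.next.HasDualBasesIn D.B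

/-! ### The pairings of `A` and `B` -/

/-- For `f = f₁ ⊗ f₂ ∈ V ⊗ V` and `v ∈ V`, the element `f₁ T₁(v f₂)` of `V`. -/
def slice (T : N →ₗ[k] k) (f : D.V ⊗[k] D.V) (v : D.V) : D.V :=
  TensorProduct.rid k D.V
    (((D.T₁ T ∘ₗ D.V.val.toLinearMap) ∘ₗ LinearMap.mulLeft k v).lTensor D.V f)

/-- The pairing `⟨a, b⟩ = λ⁻² T₂(a e₂ e₁ w b)`. -/
def pairing (T : N →ₗ[k] k) (w : D.V) : D.A →ₗ[k] D.B →ₗ[k] k :=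
  LinearMap.mk₂ k
    (fun a b => D.lam⁻¹ ^ 2 • D.T₂ T (D.ι₂ a * D.e₂ * D.ι₂ D.e₁ * D.ι₂ w * b))
    (fun a a' b => by
      rw [Subalgebra.coe_add, map_add]
      simp only [add_mul, map_add, smul_add])
    (fun c a b => by
      rw [Subalgebra.coe_smul, map_smul]
      simp only [smul_mul_assoc, map_smul]
      exact smul_comm _ _ _)
    (fun a b b' => by rw [Subalgebra.coe_add, mul_add, map_add, smul_add])
    (fun c a b => by
      rw [Subalgebra.coe_smul, mul_smul_comm, map_smul]
      exact smul_comm _ _ _)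

/-- The pairing `⟨a, b⟩' = λ⁻² T₂(b e₁ e₂ w a)`. -/
def pairing' (T : N →ₗ[k] k) (w : D.V) : D.A →ₗ[k] D.B →ₗ[k] k :=
  LinearMap.mk₂ k
    (fun a b => D.lam⁻¹ ^ 2 • D.T₂ T (b * D.ι₂ D.e₁ * D.e₂ * D.ι₂ w * D.ι₂ a))
    (fun a a' b => by rw [Subalgebra.coe_add, map_add, mul_add, map_add, smul_add])
    (fun c a b => by
      rw [Subalgebra.coe_smul, map_smul, mul_smul_comm, map_smul]
      exact smul_comm _ _ _)
    (fun a b b' => by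
      rw [Subalgebra.coe_add]
      simp only [add_mul, map_add, smul_add])
    (fun c a b => by
      rw [Subalgebra.coe_smul]
      simp only [smul_mul_assoc, map_smul]
      exact smul_comm _ _ _)

/-- The relations that define the comultiplication `Δ`, counit `ε` and antipode `S` of `B`:
`⟨a, b₁⟩ ⟨a', b₂⟩ = ⟨a a', b⟩`, `ε(b) = ⟨1, b⟩` and `⟨a, S(b)⟩' = ⟨a, b⟩`. -/
structure IsDualStructure (T : N →ₗ[k] k) (w : D.V) (Δ : D.B →ₗ[k] D.B ⊗[k] D.B)
    (ε : D.B →ₗ[k] k) (S : D.B →ₗ[k] D.B) : Prop where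
  comul : ∀ (a a' : D.A) (b : D.B),
    LinearMap.mul' k k (TensorProduct.map (D.pairing T w a) (D.pairing T w a') (Δ b)) =
      D.pairing T w (a * a') b
  counit : ∀ b : D.B, ε b = D.pairing T w 1 b
  antipode : ∀ (a : D.A) (b : D.B), D.pairing' T w a (S b) = D.pairing T w a b

end StronglySeparable

end BasicConstruction

/-! `B` acts on `A` by evaluating endomorphisms of `M₁`, and cyclicity of the traces turns the
pairing into `⟨a, b⟩ = κ(b(a))` with `κ(a) = T₀((w a)(1))` (`pairing_eq_kappa`). Everything needed
about the tower is packed into `WeakHopfDatum`; the rest is algebra of this action.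

Separability data: right multiplication is an anti-isomorphism `U → V` under which `T₀` corresponds
to `T₁` (`T₁_rmul`, the only use of the symmetric product condition). So `V` inherits a symmetric
separability element and a nondegenerate trace, and `w` normalizes the Casimir element to dual bases
for `κ` on `V` (`exists_unit_contract`).

Comultiplication: dual bases in `B` give a Leibniz rule `b(xy) = b₁(x) b₂(y)` (`exists_leibniz`).
The tensor is not unique, but multiplying it by `∑ R(f₁) ⊗ L(f₂)` makes it canonical, because `κ(x
f₁) κ(f₂ y) = κ(xy)`. Coassociativity, multiplicativity and the unit and counit axioms then follow
from associativity in `A` and nondegeneracy.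

Antipode: `S` is the transpose for the trace `T₁`, conjugated by right multiplication by `w`.
Transposing the Leibniz rule gives `S(h₁) h₂`. For `h₁ S(h₂)` the integral `E = e₂` is used:
nondegeneracy yields a map `s` with `s(h) E₁ ⊗ E₂ = E₁ ⊗ h E₂` (`exists_coantipode`), whence `h₁
s(h₂) = ε_t(h)`, and the usual uniqueness of convolution inverses gives `s = S`
(`antipode_eq_coantipode`). Finally `E₁ ⊗ S(E₂)` is a separability element of `B`, so `B` is
semisimple. -/

/-! ### Separation in tensor products -/

/-- If a family of functionals separates the points of `F`, then it separates the points of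
`E ⊗ F` when applied to the second factor. -/
theorem TensorProduct.eq_zero_of_forall_lTensor_eq_zero {k X E F : Type*} [Field k]
    [AddCommGroup E] [Module k E] [AddCommGroup F] [Module k F] (Q : X → F →ₗ[k] k)
    (hQ : ∀ y, (∀ x, Q x y = 0) → y = 0) (t : E ⊗[k] F)
    (ht : ∀ x, TensorProduct.rid k E ((Q x).lTensor E t) = 0) : t = 0 := by
  classical
  let b := Module.Basis.ofVectorSpace k E
  have key : ∀ (x : X) (i) (t : E ⊗[k] F),
      Q x (TensorProduct.equivFinsuppOfBasisLeft b t i) =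
        b.repr (TensorProduct.rid k E ((Q x).lTensor E t)) i := by
    intro x i t
    induction t with
    | zero => simp
    | tmul p q => simp [mul_comm]
    | add p q hp hq => simp only [map_add, Finsupp.add_apply, hp, hq]
  apply (TensorProduct.equivFinsuppOfBasisLeft b).injective
  ext i
  rw [map_zero, Finsupp.zero_apply]
  refine hQ _ fun x => ?_
  rw [key, ht, map_zero, Finsupp.zero_apply]

/-- An algebra with a separability element is semisimple. -/
theorem isSemisimpleRing_of_separabilityElement {k R : Type*} [Field k] [Ring R] [Algebra k R]
    (J : R ⊗[k] R) (hmul : LinearMap.mul' k R J = 1)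
    (hJ : ∀ r : R, (r ⊗ₜ[k] (1 : R)) * J = J * ((1 : R) ⊗ₜ[k] r)) : IsSemisimpleRing R := by
  refine @IsSemisimpleModule.mk _ _ _ _ _ ⟨fun I => ?_⟩
  let I' : Submodule k R := I.restrictScalars k
  obtain ⟨p, hp⟩ := I'.subtype.exists_leftInverse_of_injective (by
    rw [Submodule.ker_subtype])
  have hp' : ∀ x : I', p x = x := fun x => LinearMap.congr_fun hp x
  -- Maschke averaging: for a `k`-linear projection `p` onto `I`, the map `x ↦ J₁ p(J₂ x)` is an
  -- `R`-linear projection.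
  let avg : R → R ⊗[k] R →ₗ[k] R := fun x =>
    LinearMap.mul' k R ∘ₗ (I'.subtype ∘ₗ p ∘ₗ LinearMap.mulRight k x).lTensor R
  have avg_tmul : ∀ x a b : R, avg x (a ⊗ₜ b) = a * (p (b * x) : R) := fun x a b => by
    simp [avg]
  have avg_mem : ∀ (x : R) (t : R ⊗[k] R), avg x t ∈ I := by
    intro x t
    induction t with
    | zero => simp
    | tmul a b => rw [avg_tmul]; exact I.smul_mem a (p (b * x)).2
    | add s t hs ht => rw [map_add]; exact I.add_mem hs ht
  have avg_left : ∀ (r x : R) (t : R ⊗[k] R), avg x ((r ⊗ₜ 1) * t) = r * avg x t := by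
    intro r x t
    induction t with
    | zero => simp
    | tmul a b =>
      rw [Algebra.TensorProduct.tmul_mul_tmul, avg_tmul, avg_tmul, one_mul, mul_assoc]
    | add s t hs ht => rw [mul_add, map_add, map_add, mul_add, hs, ht]
  have avg_right : ∀ (r x : R) (t : R ⊗[k] R), avg x (t * (1 ⊗ₜ r)) = avg (r * x) t := by
    intro r x t
    induction t with
    | zero => simp
    | tmul a b =>
      rw [Algebra.TensorProduct.tmul_mul_tmul, avg_tmul, avg_tmul, mul_one, mul_assoc]
    | add s t hs ht => rw [add_mul, map_add, map_add, hs, ht]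
  have avg_self : ∀ (x : R), x ∈ I → ∀ t : R ⊗[k] R, avg x t = LinearMap.mul' k R t * x := by
    intro x hx t
    induction t with
    | zero => simp
    | tmul a b =>
      rw [avg_tmul, hp' ⟨b * x, I.smul_mem b hx⟩, LinearMap.mul'_apply, mul_assoc]
    | add s t hs ht => rw [map_add, map_add, add_mul, hs, ht]
  let P : R →ₗ[R] I :=
    { toFun := fun x => ⟨avg x J, avg_mem x J⟩
      map_add' := fun x y => by
        apply Subtype.ext
        change avg (x + y) J = avg x J + avg y J
        have : LinearMap.mulRight k (x + y) = LinearMap.mulRight k x + LinearMap.mulRight k y := by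
          ext z; simp [mul_add]
        simp only [avg, this, LinearMap.comp_add, LinearMap.lTensor_add, LinearMap.add_apply]
      map_smul' := fun r x => by
        apply Subtype.ext
        change avg (r * x) J = r * avg x J
        rw [← avg_right, ← hJ, avg_left] }
  exact ⟨LinearMap.ker P, LinearMap.isCompl_of_proj fun x => Subtype.ext (by
    change avg x J = x
    rw [avg_self x x.2, hmul, one_mul])⟩

/-! ### Weak Hopf algebras from module algebras with a nondegenerate pairing -/

/-- A finite-dimensional algebra `B` acting on a finite-dimensional algebra `A` with a
nondegenerate trace `tr`, together with a separable subalgebra `V` of `A` whose left and right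
multiplications on `A` come from `B`, a functional `κ` on `A` such that `κ (b a)` is a
nondegenerate pairing, and an integral `E ∈ B`, such that every `b ∈ B` has a transpose with
respect to the trace and satisfies a Leibniz rule `b (x y) = b₁(x) b₂(y)`. -/
structure WeakHopfDatum (k A B V : Type*) [Field k] [Ring A] [Algebra k A] [Ring B] [Algebra k B]
    [Ring V] [Algebra k V] where
  act : B →ₐ[k] Module.End k A
  incl : V →ₐ[k] A
  left : V →ₗ[k] B
  right : V →ₗ[k] B
  act_left : ∀ v a, act (left v) a = incl v * a
  act_right : ∀ v a, act (right v) a = a * incl v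
  act_incl : ∀ b v, ∃ v', act b (incl v) = incl v'
  tr : A →ₗ[k] k
  tr_comm : ∀ a a', tr (a * a') = tr (a' * a)
  tr_nondegenerate : ∀ a, (∀ a', tr (a * a') = 0) → a = 0
  transpose : ∀ b, ∃ b', ∀ x y, tr (act b x * y) = tr (x * act b' y)
  n : ℕ
  f₁ : Fin n → V
  f₂ : Fin n → V
  w : Vˣ
  w_comm : ∀ v : V, ↑w * v = v * w
  sum_f₁_mul_f₂ : ∑ i, f₁ i * f₂ i = 1
  sum_f₂_mul_f₁ : ∑ i, f₂ i * f₁ i = 1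
  casimir : ∀ v, ∑ i, (f₁ i * v) ⊗ₜ[k] f₂ i = ∑ i, f₁ i ⊗ₜ[k] (v * f₂ i)
  κ : A →ₗ[k] k
  κ_incl : ∀ v, κ (incl v) = tr (incl (w * v))
  κ_mul : ∀ x y, ∑ i, κ (x * incl (f₁ i)) * κ (incl (f₂ i) * y) = κ (x * y)
  sum_κ_smul_f₁ : ∀ v, ∑ i, κ (incl (f₂ i * v)) • f₁ i = v
  sum_κ_smul_f₂ : ∀ v, ∑ i, κ (incl (v * f₁ i)) • f₂ i = v
  pairing_left : ∀ a, (∀ b, κ (act b a) = 0) → a = 0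
  pairing_right : ∀ b, (∀ a, κ (act b a) = 0) → b = 0
  leibniz : ∀ b, ∃ t : B ⊗[k] B, ∀ x y,
    LinearMap.mul' k A (TensorProduct.map (act.toLinearMap.flip x) (act.toLinearMap.flip y) t) =
      act b (x * y)
  E : B
  act_E_one : act E 1 = 1
  act_act_E : ∀ b x, act b (act E x) = act b 1 * act E x
  q : Aˣ
  κ_act_E : ∀ a, κ (act E a) = tr (q * a)
  act_q_mul : ∀ b a, act b (q * a) = q * act b a

namespace WeakHopfDatum

variable {k A B V : Type*} [Field k] [Ring A] [Algebra k A] [Ring B] [Algebra k B]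
    [Ring V] [Algebra k V] (H : WeakHopfDatum k A B V)

/-- `b ↦ b(x)` -/
def ev (x : A) : B →ₗ[k] A := H.act.toLinearMap.flip x

@[simp] theorem ev_apply (x : A) (b : B) : H.ev x b = H.act b x := rfl

/-- `b ↦ κ(b(x))` -/
def pair (x : A) : B →ₗ[k] k := H.κ ∘ₗ H.ev x

@[simp] theorem pair_apply (x : A) (b : B) : H.pair x b = H.κ (H.act b x) := rfl

/-- `p ⊗ q ↦ p(x) q(y)` -/
def ev₂ (x y : A) : B ⊗[k] B →ₗ[k] A := LinearMap.mul' k A ∘ₗ TensorProduct.map (H.ev x) (H.ev y)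

@[simp] theorem ev₂_tmul (x y : A) (p q : B) : H.ev₂ x y (p ⊗ₜ q) = H.act p x * H.act q y := rfl

/-- `p ⊗ q ↦ κ(p(x)) κ(q(y))` -/
def pair₂ (x y : A) : B ⊗[k] B →ₗ[k] k :=
  LinearMap.mul' k k ∘ₗ TensorProduct.map (H.pair x) (H.pair y)

@[simp] theorem pair₂_tmul (x y : A) (p q : B) :
    H.pair₂ x y (p ⊗ₜ q) = H.κ (H.act p x) * H.κ (H.act q y) := rfl

theorem act_mul (b c : B) (x : A) : H.act (b * c) x = H.act b (H.act c x) := by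
  rw [map_mul, Module.End.mul_apply]

theorem act_one (x : A) : H.act 1 x = x := by rw [map_one, Module.End.one_apply]

theorem act_ext {b c : B} (h : ∀ x, H.act b x = H.act c x) : b = c := by
  rw [← sub_eq_zero]
  refine H.pairing_right _ fun a => ?_
  rw [map_sub, LinearMap.sub_apply, h, sub_self, map_zero]

theorem pair_ext {b c : B} (h : ∀ x, H.pair x b = H.pair x c) : b = c := by
  rw [← sub_eq_zero]
  refine H.pairing_right _ fun a => ?_
  rw [← pair_apply, map_sub, h, sub_self]

theorem left_mul (v v' : V) : H.left (v * v') = H.left v * H.left v' :=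
  H.act_ext fun x => by simp [act_left, mul_assoc]

theorem right_mul (v v' : V) : H.right (v * v') = H.right v' * H.right v :=
  H.act_ext fun x => by simp [act_right, mul_assoc]

theorem right_one : H.right 1 = 1 := H.act_ext fun x => by simp [act_right]

theorem left_mul_right (v v' : V) : H.left v * H.right v' = H.right v' * H.left v :=
  H.act_ext fun x => by simp [act_right, act_left, mul_assoc]

theorem pair₂_ext {s t : B ⊗[k] B} (h : ∀ x y, H.pair₂ x y s = H.pair₂ x y t) : s = t := by
  rw [← sub_eq_zero]
  have h' : ∀ x y, H.pair₂ x y (s - t) = 0 := fun x y => by rw [map_sub, h, sub_self]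
  generalize s - t = u at h'
  refine TensorProduct.eq_zero_of_forall_lTensor_eq_zero H.pair (H.pairing_right) u fun y => ?_
  refine H.pairing_right _ fun x => ?_
  rw [← h' x y]
  clear h'
  induction u with
  | zero => simp
  | tmul p q => simp [mul_comm]
  | add u u' hu hu' => simp only [map_add, LinearMap.add_apply, hu, hu']

/-- `∑ R(f₁) ⊗ L(f₂)`, which is `Δ(1)` -/
def one₂ : B ⊗[k] B := ∑ i, H.right (H.f₁ i) ⊗ₜ H.left (H.f₂ i)

theorem one₂_mul_tmul (p q : B) :
    H.one₂ * (p ⊗ₜ q) = ∑ i, (H.right (H.f₁ i) * p) ⊗ₜ[k] (H.left (H.f₂ i) * q) := by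
  simp [one₂, Finset.sum_mul]

/-- This is `κ_mul` read in `B ⊗ B`. It shows that `one₂ * t` depends only on the maps `(x, y) ↦
t₁(x) t₂(y)`, so any two Leibniz tensors of `b` give the same comultiplication. -/
theorem pair₂_one₂_mul (x y : A) (t : B ⊗[k] B) :
    H.pair₂ x y (H.one₂ * t) = H.κ (H.ev₂ x y t) := by
  induction t with
  | zero => simp
  | tmul p q => simp [one₂_mul_tmul, act_right, act_left, ← H.κ_mul (H.act p x) (H.act q y)]
  | add s t hs ht => simp only [mul_add, map_add, hs, ht]

theorem ev₂_one₂_mul (x y : A) (t : B ⊗[k] B) : H.ev₂ x y (H.one₂ * t) = H.ev₂ x y t := by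
  induction t with
  | zero => simp
  | tmul p q =>
    simp only [one₂_mul_tmul, map_sum, ev₂_tmul, act_mul, act_right, act_left]
    simp_rw [mul_assoc, ← Finset.mul_sum, ← mul_assoc (H.incl _), ← map_mul, ← Finset.sum_mul]
    rw [← map_sum, H.sum_f₁_mul_f₂, map_one, one_mul]
  | add s t hs ht => simp only [mul_add, map_add, hs, ht]

theorem one₂_mul_one₂_mul (t : B ⊗[k] B) : H.one₂ * (H.one₂ * t) = H.one₂ * t :=
  H.pair₂_ext fun x y => by rw [pair₂_one₂_mul, ev₂_one₂_mul, pair₂_one₂_mul]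

/-- The comultiplication, determined by `Δ(1) Δ(b) = Δ(b)` and `b₁(x) b₂(y) = b(x y)`. -/
noncomputable def comul : B →ₗ[k] B ⊗[k] B where
  toFun b := H.one₂ * (H.leibniz b).choose
  map_add' b c := H.pair₂_ext fun x y => by
    have h := fun b => (H.leibniz b).choose_spec x y
    change ∀ b, H.ev₂ x y (H.leibniz b).choose = _ at h
    rw [map_add (H.pair₂ x y), pair₂_one₂_mul, pair₂_one₂_mul, pair₂_one₂_mul, h, h, h, map_add,
      LinearMap.add_apply, map_add]
  map_smul' c b := H.pair₂_ext fun x y => by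
    have h := fun b => (H.leibniz b).choose_spec x y
    change ∀ b, H.ev₂ x y (H.leibniz b).choose = _ at h
    rw [map_smul (H.pair₂ x y), pair₂_one₂_mul, pair₂_one₂_mul, h, h, map_smul,
      LinearMap.smul_apply, map_smul, RingHom.id_apply]

theorem ev₂_comul (x y : A) (b : B) : H.ev₂ x y (H.comul b) = H.act b (x * y) := by
  change H.ev₂ x y (H.one₂ * _) = _
  rw [ev₂_one₂_mul]
  exact (H.leibniz b).choose_spec x y

theorem one₂_mul_comul (b : B) : H.one₂ * H.comul b = H.comul b := H.one₂_mul_one₂_mul _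

theorem pair₂_comul (x y : A) (b : B) : H.pair₂ x y (H.comul b) = H.κ (H.act b (x * y)) := by
  rw [← one₂_mul_comul, pair₂_one₂_mul, ev₂_comul]

theorem comul_eq_one₂_mul {b : B} {t : B ⊗[k] B} (h : ∀ x y, H.ev₂ x y t = H.act b (x * y)) :
    H.comul b = H.one₂ * t :=
  H.pair₂_ext fun x y => by rw [pair₂_comul, pair₂_one₂_mul, h]

theorem eq_comul {b : B} {t : B ⊗[k] B} (h₁ : H.one₂ * t = t)
    (h : ∀ x y, H.ev₂ x y t = H.act b (x * y)) : t = H.comul b := by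
  rw [H.comul_eq_one₂_mul h, h₁]

theorem ev₂_mul_tmul (x y : A) (s : B ⊗[k] B) (p q : B) :
    H.ev₂ x y (s * (p ⊗ₜ q)) = H.ev₂ (H.act p x) (H.act q y) s := by
  induction s with
  | zero => simp
  | tmul p' q' => simp
  | add s t hs ht => simp only [add_mul, map_add, hs, ht]

theorem ev₂_comul_mul (x y : A) (b : B) (t : B ⊗[k] B) :
    H.ev₂ x y (H.comul b * t) = H.act b (H.ev₂ x y t) := by
  induction t with
  | zero => simp
  | tmul p q => rw [ev₂_mul_tmul, ev₂_comul, ev₂_tmul]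
  | add s t hs ht => simp only [mul_add, map_add, hs, ht]

theorem comul_mul (b c : B) : H.comul (b * c) = H.comul b * H.comul c := by
  refine (H.eq_comul ?_ fun x y => ?_).symm
  · rw [← mul_assoc, one₂_mul_comul]
  · rw [ev₂_comul_mul, ev₂_comul, act_mul]

theorem comul_one : H.comul 1 = H.one₂ := by
  rw [H.comul_eq_one₂_mul (t := 1), mul_one]
  intro x y
  rw [Algebra.TensorProduct.one_def, ev₂_tmul]
  simp

theorem comul_left (v : V) : H.comul (H.left v) = H.one₂ * (H.left v ⊗ₜ 1) :=
  H.comul_eq_one₂_mul fun x y => by simp [act_left, mul_assoc]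

theorem comul_right (v : V) : H.comul (H.right v) = H.one₂ * (1 ⊗ₜ H.right v) :=
  H.comul_eq_one₂_mul fun x y => by simp [act_right, mul_assoc]

theorem one₂_mul_left_tmul (v : V) : H.one₂ * (H.left v ⊗ₜ 1) = (H.left v ⊗ₜ 1) * H.one₂ := by
  simp [one₂, Finset.sum_mul, Finset.mul_sum, left_mul_right]

theorem one₂_mul_tmul_right (v : V) : H.one₂ * (1 ⊗ₜ H.right v) = (1 ⊗ₜ H.right v) * H.one₂ := by
  simp [one₂, Finset.sum_mul, Finset.mul_sum, left_mul_right]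

theorem comul_left_mul (v : V) (b : B) :
    H.comul (H.left v * b) = (H.left v ⊗ₜ 1) * H.comul b := by
  rw [comul_mul, comul_left, one₂_mul_left_tmul, mul_assoc, one₂_mul_comul]

/-- After evaluation at `x` and `y` this is `b((x v) y) = b(x (v y))`. -/
theorem comul_mul_right_tmul (v : V) (b : B) :
    H.comul b * (H.right v ⊗ₜ 1) = H.comul b * (1 ⊗ₜ H.left v) := by
  have h : ∀ t, H.one₂ * (H.comul b * t) = H.comul b * t := fun t => by
    rw [← mul_assoc, one₂_mul_comul]
  rw [← h, ← h (1 ⊗ₜ _)]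
  refine H.pair₂_ext fun x y => ?_
  rw [pair₂_one₂_mul, pair₂_one₂_mul, ev₂_mul_tmul, ev₂_mul_tmul, ev₂_comul, ev₂_comul]
  simp [act_left, act_right, mul_assoc]

/-- The Casimir property of `f`, transported by `right` (which reverses products) and `left`. -/
theorem right_tmul_mul_one₂ (v : V) : (H.right v ⊗ₜ 1) * H.one₂ = (1 ⊗ₜ H.left v) * H.one₂ := by
  have h := congrArg (TensorProduct.map H.right H.left) (H.casimir v)
  simpa [one₂, Finset.mul_sum, right_mul, left_mul] using h

theorem right_tmul_mul_comul (v : V) (b : B) :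
    (H.right v ⊗ₜ 1) * H.comul b = (1 ⊗ₜ H.left v) * H.comul b := by
  rw [← one₂_mul_comul, ← mul_assoc, right_tmul_mul_one₂, mul_assoc]

/-! #### The coalgebra -/

/-- The counit `ε(b) = κ(b(1))`. -/
def counit : B →ₗ[k] k := H.pair 1

@[simp] theorem counit_apply (b : B) : H.counit b = H.κ (H.act b 1) := rfl

theorem counit_rTensor_comul (b : B) : H.counit.rTensor B (H.comul b) = 1 ⊗ₜ b := by
  apply (TensorProduct.lid k B).injective
  rw [TensorProduct.lid_tmul, one_smul]
  refine H.pair_ext fun x => ?_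
  have h : ∀ t, H.pair x (TensorProduct.lid k B (H.counit.rTensor B t)) = H.pair₂ 1 x t := by
    intro t
    induction t with
    | zero => simp
    | tmul p q => simp
    | add s t hs ht => simp only [map_add, hs, ht]
  rw [h, pair₂_comul, one_mul, pair_apply]

theorem counit_lTensor_comul (b : B) : H.counit.lTensor B (H.comul b) = b ⊗ₜ 1 := by
  apply (TensorProduct.rid k B).injective
  rw [TensorProduct.rid_tmul, one_smul]
  refine H.pair_ext fun x => ?_
  have h : ∀ t, H.pair x (TensorProduct.rid k B (H.counit.lTensor B t)) = H.pair₂ x 1 t := by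
    intro t
    induction t with
    | zero => simp
    | tmul p q => simp [mul_comm]
    | add s t hs ht => simp only [map_add, hs, ht]
  rw [h, pair₂_comul, mul_one, pair_apply]

/-- Paired with `x ⊗ y ⊗ z`, both sides become `κ(b(xyz))`. -/
theorem comul_coassoc (b : B) : TensorProduct.assoc k B B B (H.comul.rTensor B (H.comul b)) =
    H.comul.lTensor B (H.comul b) := by
  rw [← sub_eq_zero]
  refine TensorProduct.eq_zero_of_forall_lTensor_eq_zero
    (fun yz : A × A => H.pair₂ yz.1 yz.2) (fun t ht => H.pair₂_ext fun y z => by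
      rw [ht (y, z), map_zero]) _ fun yz => ?_
  obtain ⟨y, z⟩ := yz
  refine H.pair_ext fun x => ?_
  have h₁ : ∀ t : B ⊗[k] B, H.pair x (TensorProduct.rid k B ((H.pair₂ y z).lTensor B
      (H.comul.lTensor B t))) = H.pair₂ x (y * z) t := by
    intro t
    induction t with
    | zero => simp
    | tmul p q => simp [pair₂_comul, mul_comm]
    | add s t hs ht => simp only [map_add, hs, ht]
  have h₂ : ∀ (t : B ⊗[k] B) (q : B), H.pair x (TensorProduct.rid k B ((H.pair₂ y z).lTensor B
      (TensorProduct.assoc k B B B (t ⊗ₜ q)))) = H.pair₂ x y t * H.pair z q := by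
    intro t q
    induction t with
    | zero => simp
    | tmul p p' => simp; ring
    | add s t hs ht => simp only [TensorProduct.add_tmul, map_add, hs, ht, add_mul]
  have h₃ : ∀ t : B ⊗[k] B, H.pair x (TensorProduct.rid k B ((H.pair₂ y z).lTensor B
      (TensorProduct.assoc k B B B (H.comul.rTensor B t)))) = H.pair₂ (x * y) z t := by
    intro t
    induction t with
    | zero => simp
    | tmul p q =>
      rw [LinearMap.rTensor_tmul, h₂, pair₂_comul, pair₂_tmul, pair_apply]
    | add s t hs ht => simp only [map_add, hs, ht]
  simp only [map_sub, h₁, h₃, pair₂_comul, mul_assoc, sub_self, map_zero]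

theorem exists_act_one (b : B) : ∃ v, H.act b 1 = H.incl v := by
  simpa using H.act_incl b 1

theorem counit_mul_mul (h g f : B) : H.counit (h * g * f) =
    LinearMap.mul' k k (TensorProduct.map (H.counit ∘ₗ LinearMap.mulLeft k h)
      (H.counit ∘ₗ LinearMap.mulRight k f) (H.comul g)) := by
  have key : ∀ t : B ⊗[k] B, LinearMap.mul' k k (TensorProduct.map
      (H.counit ∘ₗ LinearMap.mulLeft k h) (H.counit ∘ₗ LinearMap.mulRight k f) (H.one₂ * t)) =
      H.κ (H.act h (H.ev₂ 1 (H.act f 1) t)) := by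
    intro t
    induction t with
    | zero => simp
    | tmul p q =>
      -- The second leg acts on `f(1)`, which lies in `V`, and there the expansion `v = ∑ κ(f₂ v)
      -- f₁` absorbs the two legs of `one₂`.
      obtain ⟨v, hv⟩ := H.exists_act_one (q * f)
      rw [act_mul] at hv
      rw [ev₂_tmul, hv, one₂_mul_tmul]
      conv_rhs => rw [← H.sum_κ_smul_f₁ v]
      simp [act_left, act_right, hv, Finset.mul_sum, mul_comm]
    | add s t hs ht => simp only [mul_add, map_add, hs, ht]
  rw [← one₂_mul_comul, key, ev₂_comul, one_mul, counit_apply, act_mul, act_mul]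

theorem counit_mul_mul' (h g f : B) : H.counit (h * g * f) =
    LinearMap.mul' k k (TensorProduct.map (H.counit ∘ₗ LinearMap.mulRight k f)
      (H.counit ∘ₗ LinearMap.mulLeft k h) (H.comul g)) := by
  have key : ∀ t : B ⊗[k] B, LinearMap.mul' k k (TensorProduct.map
      (H.counit ∘ₗ LinearMap.mulRight k f) (H.counit ∘ₗ LinearMap.mulLeft k h) (H.one₂ * t)) =
      H.κ (H.act h (H.ev₂ (H.act f 1) 1 t)) := by
    intro t
    induction t with
    | zero => simp
    | tmul p q =>
      obtain ⟨v, hv⟩ := H.exists_act_one (p * f)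
      rw [act_mul] at hv
      rw [ev₂_tmul, hv, one₂_mul_tmul]
      conv_rhs => rw [← H.sum_κ_smul_f₂ v]
      simp [act_left, act_right, hv, Finset.sum_mul]
    | add s t hs ht => simp only [mul_add, map_add, hs, ht]
  rw [← one₂_mul_comul, key, ev₂_comul, mul_one, counit_apply, act_mul, act_mul]

theorem assoc_symm_one₂ : (TensorProduct.assoc k B B B).symm ((1 : B) ⊗ₜ[k] H.one₂) =
    ∑ i, ((1 : B) ⊗ₜ[k] H.right (H.f₁ i)) ⊗ₜ[k] H.left (H.f₂ i) := by
  simp [one₂, TensorProduct.tmul_sum]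

theorem comul_comul_one : H.comul.rTensor B (H.comul 1) = (H.comul 1 ⊗ₜ[k] (1 : B)) *
    (TensorProduct.assoc k B B B).symm ((1 : B) ⊗ₜ[k] H.comul 1) := by
  rw [comul_one, assoc_symm_one₂, Finset.mul_sum]
  conv_lhs => rw [one₂]
  simp [comul_right]

theorem comul_comul_one' : H.comul.rTensor B (H.comul 1) =
    (TensorProduct.assoc k B B B).symm ((1 : B) ⊗ₜ[k] H.comul 1) *
      (H.comul 1 ⊗ₜ[k] (1 : B)) := by
  rw [comul_one]
  rw [assoc_symm_one₂, Finset.sum_mul]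
  conv_lhs => rw [one₂]
  simp [comul_right, one₂_mul_tmul_right]

end WeakHopfDatum

namespace WeakHopfDatum

variable {k A B V : Type*} [Field k] [Ring A] [Algebra k A] [Ring B] [Algebra k B]
    [Ring V] [Algebra k V] (H : WeakHopfDatum k A B V)

/-! #### The antipode -/

theorem tr_ext {x y : A} (h : ∀ a, H.tr (a * x) = H.tr (a * y)) : x = y := by
  rw [← sub_eq_zero]
  refine H.tr_nondegenerate _ fun a => ?_
  rw [H.tr_comm, mul_sub, map_sub, h, sub_self]

/-- The transpose with respect to the trace. -/
noncomputable def transp : B →ₗ[k] B where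
  toFun b := (H.transpose b).choose
  map_add' b c := H.act_ext fun y => H.tr_ext fun x => by
    have h := fun b => (H.transpose b).choose_spec x y
    rw [← h, map_add H.act, map_add H.act, LinearMap.add_apply, LinearMap.add_apply, mul_add,
      map_add, add_mul, map_add, h, h]
  map_smul' c b := H.act_ext fun y => H.tr_ext fun x => by
    have h := fun b => (H.transpose b).choose_spec x y
    rw [← h, map_smul H.act, map_smul H.act, LinearMap.smul_apply, LinearMap.smul_apply,
      mul_smul_comm, smul_mul_assoc, map_smul, map_smul, h]
    rfl

theorem tr_act_mul (b : B) (x y : A) : H.tr (H.act b x * y) = H.tr (x * H.act (H.transp b) y) :=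
  (H.transpose b).choose_spec x y

theorem eq_transp {b c : B} (h : ∀ x y, H.tr (H.act b x * y) = H.tr (x * H.act c y)) :
    H.transp b = c :=
  H.act_ext fun y => H.tr_ext fun x => by rw [← h, tr_act_mul]

theorem transp_mul (b c : B) : H.transp (b * c) = H.transp c * H.transp b :=
  H.eq_transp fun x y => by rw [act_mul, act_mul, tr_act_mul, tr_act_mul]

theorem transp_left (v : V) : H.transp (H.left v) = H.right v :=
  H.eq_transp fun x y => by
    rw [act_left, act_right, mul_assoc, H.tr_comm, mul_assoc]

theorem transp_right (v : V) : H.transp (H.right v) = H.left v :=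
  H.eq_transp fun x y => by rw [act_left, act_right, mul_assoc]

theorem transp_injective : Function.Injective H.transp := by
  intro b c h
  refine H.act_ext fun x => H.tr_ext fun y => ?_
  rw [H.tr_comm, tr_act_mul, h, ← tr_act_mul, H.tr_comm]

/-- The antipode `S(b)(x) = bᵗ(x w) w⁻¹`. -/
noncomputable def antipode : B →ₗ[k] B :=
  LinearMap.mulLeft k (H.right ↑H.w⁻¹) ∘ₗ LinearMap.mulRight k (H.right H.w) ∘ₗ H.transp

theorem antipode_apply (b : B) :
    H.antipode b = H.right ↑H.w⁻¹ * (H.transp b * H.right H.w) := rfl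

theorem right_mul_right_inv : H.right H.w * H.right ↑H.w⁻¹ = 1 := by
  rw [← right_mul, Units.inv_mul, right_one]

theorem right_inv_mul_right : H.right ↑H.w⁻¹ * H.right H.w = 1 := by
  rw [← right_mul, Units.mul_inv, right_one]

theorem act_antipode (b : B) (x : A) :
    H.act (H.antipode b) x = H.act (H.transp b) (x * H.incl H.w) * H.incl ↑H.w⁻¹ := by
  rw [antipode_apply, act_mul, act_mul, act_right, act_right]

theorem incl_inv_mul_incl : H.incl ↑H.w⁻¹ * H.incl H.w = 1 := by
  rw [← map_mul, Units.inv_mul, map_one]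

/-- With `e = e₁` this becomes the defining relation `⟨a, S(b)⟩' = ⟨a, b⟩`. -/
theorem tr_mul_act_antipode (a e : A) (b : B) :
    H.tr (H.incl H.w * a * H.act (H.antipode b) e) = H.tr (e * H.incl H.w * H.act b a) := by
  rw [act_antipode, H.tr_comm, ← mul_assoc, mul_assoc _ _ (H.incl H.w), incl_inv_mul_incl, mul_one,
    H.tr_comm, ← tr_act_mul, H.tr_comm]

theorem antipode_mul_rev (b c : B) : H.antipode (b * c) = H.antipode c * H.antipode b := by
  simp only [antipode_apply, transp_mul, mul_assoc]
  rw [← mul_assoc (H.right H.w) (H.right _), right_mul_right_inv, one_mul]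

theorem antipode_left (v : V) : H.antipode (H.left v) = H.right v := by
  rw [antipode_apply, transp_left, ← right_mul, ← right_mul, H.w_comm, mul_assoc, Units.mul_inv,
    mul_one]

theorem antipode_right (v : V) : H.antipode (H.right v) = H.left v := by
  rw [antipode_apply, transp_right, left_mul_right, ← mul_assoc, right_inv_mul_right, one_mul]

theorem antipode_injective : Function.Injective H.antipode := by
  intro b c h
  apply H.transp_injective
  have h' := congrArg (fun z => H.right H.w * z * H.right ↑H.w⁻¹) h
  simpa only [antipode_apply, ← mul_assoc, right_mul_right_inv, one_mul,
    mul_assoc _ (H.right H.w) (H.right _), mul_one] using h'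

/-- The Leibniz rule transposed: `tr(x b₁ᵗ(b₂(y))) = tr(b₁(x) b₂(y)) = tr(b(xy)) = tr(x y bᵗ(1))`.
-/
theorem act_mul_transp_comul (b : B) (y : A) :
    H.act (LinearMap.mul' k B (H.transp.rTensor B (H.comul b))) y =
      y * H.act (H.transp b) 1 := by
  refine H.tr_ext fun x => ?_
  have key : ∀ t : B ⊗[k] B, H.tr (x * H.act (LinearMap.mul' k B (H.transp.rTensor B t)) y) =
      H.tr (H.ev₂ x y t) := by
    intro t
    induction t with
    | zero => simp
    | tmul p q => simp [tr_act_mul]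
    | add s t hs ht => simp only [map_add, LinearMap.add_apply, mul_add, hs, ht]
  rw [key, ev₂_comul, ← mul_assoc, ← tr_act_mul, mul_one]

theorem act_antipode_mul_comul (b : B) (y : A) :
    H.act (LinearMap.mul' k B (H.antipode.rTensor B (H.comul b))) y =
      y * H.act (H.antipode b) 1 := by
  -- The factor `R(w)` in the antipode equals `L(w)ᵗ`, so it moves inside the transpose and `Δ(b)`
  -- is replaced by `Δ(L(w) b)`.
  have key : ∀ t : B ⊗[k] B, LinearMap.mul' k B (H.antipode.rTensor B t) =
      H.right ↑H.w⁻¹ * LinearMap.mul' k B (H.transp.rTensor B ((H.left H.w ⊗ₜ 1) * t)) := by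
    intro t
    induction t with
    | zero => simp
    | tmul p q => simp [antipode_apply, transp_mul, transp_left, mul_assoc]
    | add s t hs ht => simp only [map_add, mul_add, hs, ht]
  rw [key, ← comul_left_mul, act_mul, act_mul_transp_comul, act_antipode, act_right, transp_mul,
    transp_left, act_mul, act_right, mul_assoc]

/-- `S(b₁) b₂`, in the form `∑ κ(b(f₂)) R(f₁)`. -/
def source : B →ₗ[k] B := ∑ i, (H.pair (H.incl (H.f₂ i))).smulRight (H.right (H.f₁ i))

theorem source_apply (b : B) :
    H.source b = ∑ i, H.κ (H.act b (H.incl (H.f₂ i))) • H.right (H.f₁ i) := by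
  simp [source]

/-- `L(b(1))` -/
def target : B →ₗ[k] B :=
  ∑ i, (H.κ ∘ₗ LinearMap.mulRight k (H.incl (H.f₁ i)) ∘ₗ H.ev 1).smulRight (H.left (H.f₂ i))

theorem target_apply (b : B) :
    H.target b = ∑ i, H.κ (H.act b 1 * H.incl (H.f₁ i)) • H.left (H.f₂ i) := by
  simp [target]

theorem act_target (b : B) (x : A) : H.act (H.target b) x = H.act b 1 * x := by
  obtain ⟨v, hv⟩ := H.exists_act_one b
  rw [target_apply, hv]
  simp_rw [← map_mul, ← map_smul]
  rw [← map_sum, H.sum_κ_smul_f₂, act_left]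

theorem antipode_mul_comul (b : B) :
    LinearMap.mul' k B (H.antipode.rTensor B (H.comul b)) = H.source b := by
  refine H.act_ext fun y => ?_
  rw [act_antipode_mul_comul, source_apply]
  -- Here `S(b)(1) = bᵗ(w) w⁻¹` lies in `V`. Its coefficients against `f₁` are `κ(f₂ bᵗ(w) w⁻¹) =
  -- tr(f₂ bᵗ(w)) = tr(b(f₂) w) = κ(b(f₂))`.
  obtain ⟨v, hv⟩ := H.act_incl (H.transp b) H.w
  rw [act_antipode, one_mul, hv, ← map_mul]
  have h : ∀ i, H.κ (H.act b (H.incl (H.f₂ i))) = H.κ (H.incl (H.f₂ i * (v * ↑H.w⁻¹))) := by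
    intro i
    obtain ⟨v', hv'⟩ := H.act_incl b (H.f₂ i)
    rw [hv', H.κ_incl, map_mul, H.tr_comm, ← hv', tr_act_mul, hv, H.κ_incl, map_mul H.incl,
      map_mul H.incl (H.f₂ i), map_mul H.incl v, H.tr_comm (H.incl H.w), mul_assoc, mul_assoc,
      incl_inv_mul_incl, mul_one]
  simp_rw [h, ← map_smul H.right]
  rw [← map_sum H.right, H.sum_κ_smul_f₁, act_right]

theorem source_eq (b : B) :
    TensorProduct.rid k B (H.counit.lTensor B (((1 : B) ⊗ₜ[k] b) * H.comul 1)) = H.source b := by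
  rw [comul_one, one₂, source_apply, Finset.mul_sum]
  simp [act_left]

theorem target_eq (b : B) :
    TensorProduct.lid k B (H.counit.rTensor B (H.comul 1 * (b ⊗ₜ[k] (1 : B)))) = H.target b := by
  rw [comul_one, one₂_mul_tmul, target_apply]
  simp [act_right]

/-- `S(h₁) ε_t(h₂) = S(h)` -/
theorem mul_map_antipode_target (b : B) :
    LinearMap.mul' k B (TensorProduct.map H.antipode H.target (H.comul b)) = H.antipode b := by
  have htarget : ∀ c : B, ∃ v, H.act c 1 = H.incl v ∧ H.target c = H.left v := by
    intro c
    obtain ⟨v, hv⟩ := H.exists_act_one c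
    exact ⟨v, hv, H.act_ext fun x => by rw [act_target, hv, act_left]⟩
  -- If `q(1) = v`, then `S(p) L(v) = S(R(v) p)`, and `R(v) p` acts by `x ↦ p(x) q(1)`. For `t =
  -- Δ(b)` this is `b(x · 1)`.
  have key : ∀ t : B ⊗[k] B, ∃ c, LinearMap.mul' k B (TensorProduct.map H.antipode H.target t) =
      H.antipode c ∧ ∀ x, H.act c x = H.ev₂ x 1 t := by
    intro t
    induction t with
    | zero => exact ⟨0, by simp⟩
    | tmul p q =>
      obtain ⟨v, hv, hv'⟩ := htarget q
      exact ⟨H.right v * p, by simp [hv', antipode_mul_rev, antipode_right], fun x => by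
        simp [hv, act_right]⟩
    | add s t hs ht =>
      obtain ⟨c, hc, hc'⟩ := hs
      obtain ⟨d, hd, hd'⟩ := ht
      exact ⟨c + d, by simp only [map_add, hc, hd], fun x => by
        simp only [map_add, LinearMap.add_apply, hc', hd']⟩
  obtain ⟨c, hc, hc'⟩ := key (H.comul b)
  rw [hc, H.act_ext (b := c) (c := b) fun x => by rw [hc', ev₂_comul, mul_one]]

/-- `ε_s(h₁) s(h₂) = s(h)` for every antimultiplicative `s` with `s(L(v)) = R(v)`. -/
theorem mul_map_source (s : B →ₗ[k] B) (hs : ∀ b c, s (b * c) = s c * s b)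
    (hs' : ∀ v, s (H.left v) = H.right v) (b : B) :
    LinearMap.mul' k B (TensorProduct.map H.source s (H.comul b)) = s b := by
  have h₁ : ∀ t : B ⊗[k] B, LinearMap.mul' k B (TensorProduct.map H.source s t) =
      s (∑ i, TensorProduct.lid k B ((H.pair (H.incl (H.f₂ i))).rTensor B
        (t * (1 ⊗ₜ H.left (H.f₁ i))))) := by
    intro t
    induction t with
    | zero => simp
    | tmul p q => simp [source_apply, Finset.sum_mul, hs, hs']
    | add t t' ht ht' => simp only [map_add, add_mul, Finset.sum_add_distrib, ht, ht']
  have h₂ : ∀ (v v' : V) (t : B ⊗[k] B), (H.pair (H.incl v)).rTensor B (t * (H.right v' ⊗ₜ 1)) =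
      (H.pair (H.incl (v * v'))).rTensor B t := by
    intro v v' t
    induction t with
    | zero => simp
    | tmul p q => simp [act_right]
    | add t t' ht ht' => simp only [map_add, add_mul, ht, ht']
  rw [h₁]
  -- Moving `L(f₁)` from the second leg to `R(f₁)` on the first produces `f₂ f₁`, whose sum is `1`;
  -- what remains is the counit axiom.
  simp_rw [← comul_mul_right_tmul, h₂]
  rw [← map_sum (TensorProduct.lid k B)]
  have h₃ : ∑ i, (H.pair (H.incl (H.f₂ i * H.f₁ i))).rTensor B (H.comul b) =
      H.counit.rTensor B (H.comul b) := by
    rw [← LinearMap.sum_apply]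
    congr 1
    have : H.counit = ∑ i, H.pair (H.incl (H.f₂ i * H.f₁ i)) := by
      ext c
      rw [LinearMap.sum_apply]
      simp_rw [pair_apply]
      rw [← map_sum, ← map_sum, ← map_sum, H.sum_f₂_mul_f₁, map_one, counit_apply]
    rw [this, ← LinearMap.coe_rTensorHom, map_sum]
  rw [h₃, counit_rTensor_comul, TensorProduct.lid_tmul, one_smul]

end WeakHopfDatum

/-! ### The integral `E`, the identity for `h₁ S(h₂)`, and semisimplicity. -/

namespace WeakHopfDatum

variable {k A B V : Type*} [Field k] [Ring A] [Algebra k A] [Ring B] [Algebra k B]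
    [Ring V] [Algebra k V] (H : WeakHopfDatum k A B V)

/-- The pairing of `A` and `B` as a bilinear map. -/
def pairing : A →ₗ[k] B →ₗ[k] k := (H.act.toLinearMap.compr₂ H.κ).flip

/-- The trace form of `A`. -/
def traceForm : A →ₗ[k] A →ₗ[k] k := (LinearMap.mul k A).compr₂ H.tr

theorem act_eq_of_κ {a a' : A} (h : ∀ b, H.κ (H.act b a) = H.κ (H.act b a')) : a = a' := by
  rw [← sub_eq_zero]
  refine H.pairing_left _ fun b => ?_
  rw [map_sub, map_sub, h, sub_self]

/-- Under the pairing, left multiplication by `h` on `B` is adjoint to an operator `K` on `A`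
commuting with the action. -/
theorem κ_act_commuting {h : B} {K : A →ₗ[k] A} (hK : ∀ b a, K (H.act b a) = H.act b (K a))
    (hκ : ∀ a, H.κ (K a) = H.κ (H.act h a)) (b : B) (a : A) :
    H.κ (H.act b (K a)) = H.κ (H.act h (H.act b a)) := by rw [← hK, hκ]

theorem pair₂_comul_E (x y : A) : H.pair₂ x y (H.comul H.E) = H.tr (H.q * (x * y)) := by
  rw [pair₂_comul, κ_act_E]

theorem pair₂_tmul_one_mul {h : B} {K : A →ₗ[k] A} (hK : ∀ b a, K (H.act b a) = H.act b (K a))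
    (hκ : ∀ a, H.κ (K a) = H.κ (H.act h a)) (x y : A) (t : B ⊗[k] B) :
    H.pair₂ x y ((h ⊗ₜ 1) * t) = H.pair₂ (K x) y t := by
  induction t with
  | zero => simp
  | tmul p q => simp [H.κ_act_commuting hK hκ]
  | add s t hs ht => simp only [mul_add, map_add, hs, ht]

theorem pair₂_one_tmul_mul {h : B} {K : A →ₗ[k] A} (hK : ∀ b a, K (H.act b a) = H.act b (K a))
    (hκ : ∀ a, H.κ (K a) = H.κ (H.act h a)) (x y : A) (t : B ⊗[k] B) :
    H.pair₂ x y ((1 ⊗ₜ h) * t) = H.pair₂ x (K y) t := by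
  induction t with
  | zero => simp
  | tmul p q => simp [H.κ_act_commuting hK hκ]
  | add s t hs ht => simp only [mul_add, map_add, hs, ht]

theorem antipode_mul_antipode (h : B) :
    LinearMap.mul' k B (TensorProduct.map (LinearMap.mul' k B ∘ₗ H.antipode.rTensor B) H.antipode
      (H.comul.rTensor B (H.comul h))) = H.antipode h := by
  have h₂ : H.source = LinearMap.mul' k B ∘ₗ H.antipode.rTensor B ∘ₗ H.comul := by
    ext b
    exact (H.antipode_mul_comul b).symm
  have e : ∀ t : B ⊗[k] B, LinearMap.mul' k B (TensorProduct.map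
      (LinearMap.mul' k B ∘ₗ H.antipode.rTensor B) H.antipode (H.comul.rTensor B t)) =
      LinearMap.mul' k B (TensorProduct.map H.source H.antipode t) := by
    intro t
    induction t with
    | zero => simp
    | tmul p q => simp [h₂]
    | add s t hs ht => simp only [map_add, hs, ht]
  rw [e, H.mul_map_source _ H.antipode_mul_rev H.antipode_left]

theorem isPerfPair_pairing [FiniteDimensional k A] : H.pairing.IsPerfPair := by
  apply LinearMap.IsPerfPair.of_injective
  · rw [injective_iff_map_eq_zero]
    exact fun a ha => H.pairing_left a fun b => LinearMap.congr_fun ha b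
  · rw [injective_iff_map_eq_zero]
    exact fun b hb => H.pairing_right b fun a => LinearMap.congr_fun hb a

theorem isPerfPair_traceForm [FiniteDimensional k A] : H.traceForm.IsPerfPair := by
  apply LinearMap.IsPerfPair.of_injective
  · rw [injective_iff_map_eq_zero]
    exact fun a ha => H.tr_nondegenerate a fun b => LinearMap.congr_fun ha b
  · rw [injective_iff_map_eq_zero]
    refine fun a ha => H.tr_nondegenerate a fun b => ?_
    rw [H.tr_comm]
    exact LinearMap.congr_fun ha b

theorem antipode_bijective [FiniteDimensional k B] : Function.Bijective H.antipode :=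
  ⟨H.antipode_injective, LinearMap.injective_iff_surjective.mp H.antipode_injective⟩

/-- For each functional on `A` there is a unique endomorphism of the `B`-module `A` that `κ`
maps to it. -/
theorem exists_commuting [FiniteDimensional k A] (φ : A →ₗ[k] k) :
    ∃ K : A →ₗ[k] A, (∀ b a, K (H.act b a) = H.act b (K a)) ∧ ∀ a, H.κ (K a) = φ a := by
  have := H.isPerfPair_pairing
  have hsurj : Function.Surjective H.pairing := (LinearMap.IsPerfPair.bijective_left H.pairing).2
  -- The pairing is perfect, so `b ↦ φ(b(a))` is represented by a unique element, which is taken as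
  -- `K a`. Uniqueness gives both linearity and commutation with `B`.
  have h : ∀ a, ∃ a', ∀ b, H.κ (H.act b a') = φ (H.act b a) := fun a => by
    obtain ⟨a', ha'⟩ := hsurj (φ ∘ₗ H.ev a)
    exact ⟨a', fun b => LinearMap.congr_fun ha' b⟩
  choose K hK using h
  refine ⟨⟨⟨K, fun a a' => H.act_eq_of_κ fun b => ?_⟩, fun c a => H.act_eq_of_κ fun b => ?_⟩,
    fun b a => H.act_eq_of_κ fun c => ?_, fun a => ?_⟩
  · rw [hK, map_add, map_add, map_add, map_add, hK, hK]
  · change H.κ (H.act b (K (c • a))) = H.κ (H.act b (c • K a))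
    rw [hK, map_smul, map_smul, map_smul, map_smul, hK]
  · change H.κ (H.act c (K _)) = H.κ (H.act c (H.act b (K a)))
    rw [hK, ← act_mul, ← act_mul, hK]
  · simpa using hK a 1

section FiniteDimensional

variable [FiniteDimensional k A]

/-- Since `Δ(E)` pairs with `x ⊗ y` to `tr(q x y)`, the element `g` must correspond to the adjoint
`G` of the operator `K` of `h`, for the nondegenerate form `tr(q x y)`. -/
theorem exists_coantipode (h : B) :
    ∃ g : B, (g ⊗ₜ 1) * H.comul H.E = (1 ⊗ₜ h) * H.comul H.E := by
  obtain ⟨K, hK, hKκ⟩ := H.exists_commuting (H.κ ∘ₗ H.act h)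
  replace hKκ : ∀ a, H.κ (K a) = H.κ (H.act h a) := hKκ
  have := H.isPerfPair_traceForm
  have := H.isPerfPair_pairing
  have hsurj : Function.Surjective H.traceForm :=
    (LinearMap.IsPerfPair.bijective_left H.traceForm).2
  have hsurj' : Function.Surjective H.pairing.flip :=
    (LinearMap.IsPerfPair.bijective_right H.pairing).2
  have tr_ext' : ∀ {a a' : A}, (∀ y, H.tr (H.q * (a * y)) = H.tr (H.q * (a' * y))) → a = a' := by
    intro a a' haa'
    have : (H.q : A) * a = H.q * a' := H.tr_ext fun y => by
      rw [H.tr_comm, mul_assoc, haa', ← mul_assoc, H.tr_comm]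
    exact H.q.mul_right_inj.mp this
  have hG : ∀ a, ∃ a', ∀ y, H.tr (H.q * (a' * y)) = H.tr (H.q * (a * K y)) := fun a => by
    obtain ⟨d, hd⟩ := hsurj (H.tr ∘ₗ LinearMap.mulLeft k (H.q * a) ∘ₗ K)
    refine ⟨↑H.q⁻¹ * d, fun y => ?_⟩
    have : H.tr (d * y) = _ := LinearMap.congr_fun hd y
    simpa [← mul_assoc] using this
  choose G hG using hG
  let G' : A →ₗ[k] A :=
    { toFun := G
      map_add' := fun a a' => tr_ext' fun y => by
        simp only [hG, add_mul, mul_add, map_add]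
      map_smul' := fun c a => tr_ext' fun y => by
        simp only [hG, RingHom.id_apply, smul_mul_assoc, mul_smul_comm, map_smul] }
  have hG' : ∀ a y, H.tr (H.q * (G' a * y)) = H.tr (H.q * (a * K y)) := hG
  -- `G'` commutes with `B` because `K` does, `B` is closed under transposes, and `B` commutes with
  -- left multiplication by `q`.
  have hGact : ∀ b a, G' (H.act b a) = H.act b (G' a) := fun b a => tr_ext' fun y => by
    rw [hG', ← mul_assoc, ← mul_assoc, ← act_q_mul, ← act_q_mul, tr_act_mul, tr_act_mul, ← hK,
      mul_assoc, mul_assoc, hG']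
  obtain ⟨g, hg⟩ := hsurj' (H.κ ∘ₗ G')
  have hgκ : ∀ a, H.κ (G' a) = H.κ (H.act g a) := fun a => (LinearMap.congr_fun hg a).symm
  refine ⟨g, H.pair₂_ext fun x y => ?_⟩
  rw [H.pair₂_tmul_one_mul hGact hgκ, H.pair₂_one_tmul_mul hK hKκ, pair₂_comul_E, pair₂_comul_E,
    hG']

theorem tmul_one_mul_comul_E_injective {g g' : B}
    (h : (g ⊗ₜ 1) * H.comul H.E = (g' ⊗ₜ 1) * H.comul H.E) : g = g' := by
  obtain ⟨K, hK, hKκ⟩ := H.exists_commuting (H.κ ∘ₗ H.act g)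
  obtain ⟨K', hK', hKκ'⟩ := H.exists_commuting (H.κ ∘ₗ H.act g')
  refine H.pair_ext fun x => ?_
  rw [pair_apply, pair_apply]
  have : K x = K' x := by
    have : (H.q : A) * K x = H.q * K' x := H.tr_ext fun y => by
      rw [H.tr_comm, mul_assoc, ← pair₂_comul_E, ← H.pair₂_tmul_one_mul hK hKκ, h,
        H.pair₂_tmul_one_mul hK' hKκ', pair₂_comul_E, ← mul_assoc, H.tr_comm]
    exact H.q.mul_right_inj.mp this
  rw [← LinearMap.comp_apply, ← hKκ, this, hKκ', LinearMap.comp_apply]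

/-- The map `s` with `s(h) E₁ ⊗ E₂ = E₁ ⊗ h E₂`, which turns out to be the antipode. -/
noncomputable def coantipode : B →ₗ[k] B where
  toFun h := (H.exists_coantipode h).choose
  map_add' h h' := H.tmul_one_mul_comul_E_injective <| by
    have hs := fun h => (H.exists_coantipode h).choose_spec
    rw [hs, TensorProduct.add_tmul, add_mul, hs, hs, ← add_mul, ← TensorProduct.tmul_add]
  map_smul' c h := H.tmul_one_mul_comul_E_injective <| by
    have hs := fun h => (H.exists_coantipode h).choose_spec
    rw [hs, ← TensorProduct.smul_tmul', smul_mul_assoc, hs, TensorProduct.tmul_smul,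
      smul_mul_assoc, RingHom.id_apply]

theorem coantipode_tmul_mul (h : B) :
    (H.coantipode h ⊗ₜ 1) * H.comul H.E = (1 ⊗ₜ h) * H.comul H.E :=
  (H.exists_coantipode h).choose_spec

theorem coantipode_mul_rev (g h : B) :
    H.coantipode (g * h) = H.coantipode h * H.coantipode g := by
  apply H.tmul_one_mul_comul_E_injective
  have h₁ : ∀ a b : B, (a ⊗ₜ[k] (1 : B)) * (1 ⊗ₜ b) = (1 ⊗ₜ b) * (a ⊗ₜ 1) := by simp
  have h₂ : ∀ a b : B, ((a * b) ⊗ₜ[k] (1 : B)) = (a ⊗ₜ 1) * (b ⊗ₜ 1) := by simp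
  have h₃ : ∀ a b : B, ((1 : B) ⊗ₜ[k] (a * b)) = (1 ⊗ₜ a) * (1 ⊗ₜ b) := by simp
  rw [coantipode_tmul_mul, h₂, h₃, mul_assoc, mul_assoc, coantipode_tmul_mul,
    ← mul_assoc (H.coantipode h ⊗ₜ[k] (1 : B)), h₁, mul_assoc, coantipode_tmul_mul]

theorem coantipode_left (v : V) : H.coantipode (H.left v) = H.right v := by
  apply H.tmul_one_mul_comul_E_injective
  rw [coantipode_tmul_mul, right_tmul_mul_comul]

/-- Multiplying by `Δ(E)`: `h₁ s(h₂) E₁ ⊗ E₂ = h₁ E₁ ⊗ h₂ E₂ = Δ(h E)`, and `h E = L(h(1)) E` by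
`act_act_E`. -/
theorem mul_coantipode_comul (h : B) :
    LinearMap.mul' k B (H.coantipode.lTensor B (H.comul h)) = H.target h := by
  apply H.tmul_one_mul_comul_E_injective
  have key : ∀ t : B ⊗[k] B, (LinearMap.mul' k B (H.coantipode.lTensor B t) ⊗ₜ[k] (1 : B)) *
      H.comul H.E = t * H.comul H.E := by
    intro t
    induction t with
    | zero => simp
    | tmul p q =>
      have h₁ : ((p * H.coantipode q) ⊗ₜ[k] (1 : B)) = (p ⊗ₜ 1) * (H.coantipode q ⊗ₜ 1) := by simp
      rw [LinearMap.lTensor_tmul, LinearMap.mul'_apply, h₁, mul_assoc, coantipode_tmul_mul,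
        ← mul_assoc]
      simp
    | add s t hs ht => simp only [map_add, TensorProduct.add_tmul, add_mul, hs, ht]
  rw [key, ← comul_mul]
  obtain ⟨v, hv⟩ := H.exists_act_one h
  have h₁ : H.target h = H.left v := H.act_ext fun x => by rw [act_target, hv, act_left]
  rw [h₁, ← comul_left_mul]
  congr 1
  exact H.act_ext fun x => by rw [act_mul, act_mul, act_act_E, hv, act_left]

/-- Both sides equal `S(h₁) h₂ s(h₃)`: bracketing on the right gives `S(h₁) ε_t(h₂) = S(h)`, on the
left `ε_s(h₁) s(h₂) = s(h)`. -/
theorem antipode_eq_coantipode : H.antipode = H.coantipode := by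
  ext h
  rw [← H.mul_map_antipode_target, ← H.mul_map_source H.coantipode H.coantipode_mul_rev
    H.coantipode_left]
  have h₁ : H.target = LinearMap.mul' k B ∘ₗ H.coantipode.lTensor B ∘ₗ H.comul := by
    ext b
    exact (H.mul_coantipode_comul b).symm
  have h₂ : H.source = LinearMap.mul' k B ∘ₗ H.antipode.rTensor B ∘ₗ H.comul := by
    ext b
    exact (H.antipode_mul_comul b).symm
  let Θ : B ⊗[k] (B ⊗[k] B) →ₗ[k] B := LinearMap.mul' k B ∘ₗ TensorProduct.map H.antipode
    (LinearMap.mul' k B ∘ₗ H.coantipode.lTensor B)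
  have e₁ : ∀ t : B ⊗[k] B, LinearMap.mul' k B (TensorProduct.map H.antipode H.target t) =
      Θ (H.comul.lTensor B t) := by
    intro t
    induction t with
    | zero => simp
    | tmul p q => simp [Θ, h₁]
    | add s t hs ht => simp only [map_add, hs, ht]
  have e₂ : ∀ (t : B ⊗[k] B) (q : B),
      LinearMap.mul' k B (H.antipode.rTensor B t) * H.coantipode q =
        Θ (TensorProduct.assoc k B B B (t ⊗ₜ q)) := by
    intro t q
    induction t with
    | zero => simp
    | tmul p p' => simp [Θ, mul_assoc]
    | add s t hs ht => simp only [map_add, TensorProduct.add_tmul, add_mul, hs, ht]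
  have e₃ : ∀ t : B ⊗[k] B, LinearMap.mul' k B (TensorProduct.map H.source H.coantipode t) =
      Θ (TensorProduct.assoc k B B B (H.comul.rTensor B t)) := by
    intro t
    induction t with
    | zero => simp
    | tmul p q =>
      rw [TensorProduct.map_tmul, LinearMap.rTensor_tmul, ← e₂, h₂]
      rfl
    | add s t hs ht => simp only [map_add, hs, ht]
  rw [e₁, e₃, comul_coassoc]

theorem mul_antipode_comul (h : B) :
    LinearMap.mul' k B (H.antipode.lTensor B (H.comul h)) = H.target h := by
  rw [antipode_eq_coantipode, mul_coantipode_comul]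

theorem isSemisimpleRing [FiniteDimensional k B] (H : WeakHopfDatum k A B V) : IsSemisimpleRing B := by
  -- For `E₁ ⊗ S(E₂)`, the product is `ε_t(E) = L(E(1)) = 1`, and the Casimir identity for `S(h)` is
  -- the defining relation of `coantipode`.
  refine isSemisimpleRing_of_separabilityElement (k := k) (H.antipode.lTensor B (H.comul H.E))
    ?_ fun h => ?_
  · rw [mul_antipode_comul]
    exact H.act_ext fun x => by rw [act_target, H.act_E_one, one_mul, act_one]
  · obtain ⟨h, rfl⟩ := H.antipode_bijective.2 h
    have e₁ : ∀ (g : B) (t : B ⊗[k] B), H.antipode.lTensor B ((g ⊗ₜ 1) * t) =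
        (g ⊗ₜ 1) * H.antipode.lTensor B t := by
      intro g t
      induction t with
      | zero => simp
      | tmul p q => simp
      | add s t hs ht => simp only [map_add, mul_add, hs, ht]
    have e₂ : ∀ (g : B) (t : B ⊗[k] B), H.antipode.lTensor B ((1 ⊗ₜ g) * t) =
        H.antipode.lTensor B t * (1 ⊗ₜ H.antipode g) := by
      intro g t
      induction t with
      | zero => simp
      | tmul p q => simp [antipode_mul_rev]
      | add s t hs ht => simp only [map_add, mul_add, add_mul, hs, ht]
    rw [← e₁, ← e₂, antipode_eq_coantipode, coantipode_tmul_mul]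

/-- The weak Hopf algebra of a `WeakHopfDatum`. -/
noncomputable abbrev weakHopfAlgebra : WeakHopfAlgebra k B where
  comul := H.comul
  counit := H.counit
  coassoc := LinearMap.ext H.comul_coassoc
  rTensor_counit_comp_comul := LinearMap.ext H.counit_rTensor_comul
  lTensor_counit_comp_comul := LinearMap.ext H.counit_lTensor_comul
  antipode := H.antipode
  comul_mul := H.comul_mul
  counit_mul_mul := H.counit_mul_mul
  counit_mul_mul' := H.counit_mul_mul'
  comul_comul_one := H.comul_comul_one
  comul_comul_one' := H.comul_comul_one'
  mul_antipode h := (H.mul_antipode_comul h).trans (H.target_eq h).symm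
  antipode_mul h := (H.antipode_mul_comul h).trans (H.source_eq h).symm
  antipode_mul_antipode := H.antipode_mul_antipode

end FiniteDimensional

end WeakHopfDatum

/-! ### Symmetric separability elements -/

namespace IsSymmetricSeparabilityElement

variable {k R : Type*} [Field k] [Ring R] [Algebra k R] {f : R ⊗[k] R}

theorem comm_mul (s t : R ⊗[k] R) : TensorProduct.comm k R R (s * t) =
    TensorProduct.comm k R R s * TensorProduct.comm k R R t :=
  map_mul (Algebra.TensorProduct.comm k R R) s t

theorem casimir' (hf : IsSymmetricSeparabilityElement k f) (r : R) :
    f * (r ⊗ₜ[k] (1 : R)) = ((1 : R) ⊗ₜ[k] r) * f := by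
  have h := congrArg (TensorProduct.comm k R R) (hf.casimir r)
  rw [comm_mul, comm_mul, hf.symm, TensorProduct.comm_tmul, TensorProduct.comm_tmul] at h
  exact h.symm

theorem mul'_comm (hf : IsSymmetricSeparabilityElement k f) :
    LinearMap.mul' k R (TensorProduct.comm k R R f) = 1 := by
  rw [hf.symm, hf.mul_eq_one]

/-- Both elements equal `∑ p'ⱼ pᵢ ⊗ qᵢ q'ⱼ`: each Casimir property lets the other element collapse
to `1`. Symmetry supplies `∑ qᵢ pᵢ = 1`. -/
theorem unique {f' : R ⊗[k] R} (hf : IsSymmetricSeparabilityElement k f)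
    (hf' : IsSymmetricSeparabilityElement k f') : f = f' := by
  obtain ⟨n, p, q, h⟩ := TensorProduct.exists_sum_tmul_eq f
  obtain ⟨n', p', q', h'⟩ := TensorProduct.exists_sum_tmul_eq f'
  have h₁ : ∑ j, (p' j ⊗ₜ[k] (1 : R)) * f * ((1 : R) ⊗ₜ[k] q' j) = f := by
    have : ∀ j, (p' j ⊗ₜ[k] (1 : R)) * f * ((1 : R) ⊗ₜ[k] q' j) =
        f * ((1 : R) ⊗ₜ[k] (p' j * q' j)) := fun j => by
      rw [hf.casimir, mul_assoc, Algebra.TensorProduct.tmul_mul_tmul, mul_one]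
    simp_rw [this]
    rw [← Finset.mul_sum, ← TensorProduct.tmul_sum]
    have h₂ := hf'.mul_eq_one
    rw [h', map_sum] at h₂
    simp only [LinearMap.mul'_apply] at h₂
    rw [h₂, ← Algebra.TensorProduct.one_def, mul_one]
  have h₂ : ∑ i, ((1 : R) ⊗ₜ[k] q i) * f' * (p i ⊗ₜ[k] (1 : R)) = f' := by
    have : ∀ i, ((1 : R) ⊗ₜ[k] q i) * f' * (p i ⊗ₜ[k] (1 : R)) =
        ((1 : R) ⊗ₜ[k] (q i * p i)) * f' := fun j => by
      rw [mul_assoc, hf'.casimir', ← mul_assoc, Algebra.TensorProduct.tmul_mul_tmul, mul_one]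
    simp_rw [this]
    rw [← Finset.sum_mul, ← TensorProduct.tmul_sum]
    have h₂ := hf.mul'_comm
    rw [h, map_sum, map_sum] at h₂
    simp only [TensorProduct.comm_tmul, LinearMap.mul'_apply] at h₂
    rw [h₂, ← Algebra.TensorProduct.one_def, one_mul]
  rw [← h₁, ← h₂, h, h']
  simp only [Finset.mul_sum, Finset.sum_mul, Algebra.TensorProduct.tmul_mul_tmul, one_mul, mul_one]
  exact Finset.sum_comm

/-- Transport along an anti-isomorphism. -/
theorem map_anti {S : Type*} [Ring S] [Algebra k S] (hf : IsSymmetricSeparabilityElement k f)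
    (φ : R →ₗ[k] S) (hφ : ∀ a b, φ (a * b) = φ b * φ a) (h1 : φ 1 = 1)
    (hsurj : Function.Surjective φ) :
    IsSymmetricSeparabilityElement k (TensorProduct.map φ φ f) := by
  have hmul : ∀ s t : R ⊗[k] R, TensorProduct.map φ φ (s * t) =
      TensorProduct.map φ φ t * TensorProduct.map φ φ s := by
    intro s t
    induction s with
    | zero => simp
    | add s s' hs hs' => simp only [add_mul, map_add, mul_add, hs, hs']
    | tmul a b =>
      induction t with
      | zero => simp
      | add t t' ht ht' => simp only [add_mul, map_add, mul_add, ht, ht']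
      | tmul c d => simp [hφ]
  have hcomm : ∀ s : R ⊗[k] R, TensorProduct.comm k S S (TensorProduct.map φ φ s) =
      TensorProduct.map φ φ (TensorProduct.comm k R R s) := by
    intro s
    induction s with
    | zero => simp
    | add s s' hs hs' => simp only [map_add, hs, hs']
    | tmul a b => simp
  refine ⟨?_, fun s => ?_, ?_⟩
  · have : ∀ s : R ⊗[k] R, LinearMap.mul' k S (TensorProduct.map φ φ s) =
        φ (LinearMap.mul' k R (TensorProduct.comm k R R s)) := by
      intro s
      induction s with
      | zero => simp
      | add s s' hs hs' => simp only [map_add, hs, hs']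
      | tmul a b => simp [hφ]
    rw [this, hf.mul'_comm, h1]
  · obtain ⟨r, rfl⟩ := hsurj s
    have h := congrArg (TensorProduct.map φ φ) (hf.casimir' r)
    rw [hmul, hmul] at h
    simpa [h1] using h
  · rw [hcomm, hf.symm]

/-- The element `f₁ t(v f₂)`. -/
def contract (f : R ⊗[k] R) (t : R →ₗ[k] k) (v : R) : R :=
  TensorProduct.rid k R ((t ∘ₗ LinearMap.mulLeft k v).lTensor R f)

theorem contract_eq_rid (t : R →ₗ[k] k) (v : R) (s : R ⊗[k] R) :
    contract s t v = TensorProduct.rid k R (t.lTensor R (((1 : R) ⊗ₜ[k] v) * s)) := by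
  unfold contract
  induction s with
  | zero => simp
  | add s s' hs hs' => simp only [map_add, mul_add, hs, hs']
  | tmul a b => simp

theorem rid_lTensor_tmul_one_mul (t : R →ₗ[k] k) (v : R) (s : R ⊗[k] R) :
    TensorProduct.rid k R (t.lTensor R ((v ⊗ₜ[k] (1 : R)) * s)) =
      v * TensorProduct.rid k R (t.lTensor R s) := by
  induction s with
  | zero => simp
  | add s s' hs hs' => simp only [map_add, mul_add, hs, hs']
  | tmul a b => simp

theorem rid_lTensor_mul_tmul_one (t : R →ₗ[k] k) (v : R) (s : R ⊗[k] R) :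
    TensorProduct.rid k R (t.lTensor R (s * (v ⊗ₜ[k] (1 : R)))) =
      TensorProduct.rid k R (t.lTensor R s) * v := by
  induction s with
  | zero => simp
  | add s s' hs hs' => simp only [map_add, add_mul, hs, hs']
  | tmul a b => simp

theorem rid_lTensor_mul_one_tmul {t : R →ₗ[k] k} (ht : ∀ a b, t (a * b) = t (b * a)) (v : R)
    (s : R ⊗[k] R) : TensorProduct.rid k R (t.lTensor R (s * ((1 : R) ⊗ₜ[k] v))) =
      TensorProduct.rid k R (t.lTensor R (((1 : R) ⊗ₜ[k] v) * s)) := by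
  induction s with
  | zero => simp
  | add s s' hs hs' => simp only [map_add, add_mul, mul_add, hs, hs']
  | tmul a b => simp [ht b v]

theorem contract_one (t : R →ₗ[k] k) :
    contract f t 1 = TensorProduct.rid k R (t.lTensor R f) := by
  rw [contract_eq_rid, ← Algebra.TensorProduct.one_def, one_mul]

theorem contract_eq_mul (hf : IsSymmetricSeparabilityElement k f) (t : R →ₗ[k] k) (v : R) :
    contract f t v = contract f t 1 * v := by
  rw [contract_one, contract_eq_rid, ← hf.casimir', rid_lTensor_mul_tmul_one]

theorem contract_one_comm (hf : IsSymmetricSeparabilityElement k f) {t : R →ₗ[k] k}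
    (ht : ∀ a b, t (a * b) = t (b * a)) (v : R) : contract f t 1 * v = v * contract f t 1 := by
  rw [← hf.contract_eq_mul, contract_one, contract_eq_rid, ← rid_lTensor_mul_one_tmul ht,
    ← hf.casimir, rid_lTensor_tmul_one_mul]

/-- The hypothesis makes every slice `f₁ t(y x f₂)` vanish, so `f₁ ⊗ x f₂ = 0` by nondegeneracy, and
multiplying out in reverse order gives `x = 0`. -/
theorem eq_zero_of_contract_mul_eq_zero (hf : IsSymmetricSeparabilityElement k f) {t : R →ₗ[k] k}
    (ht : ∀ a b, t (a * b) = t (b * a)) (hnd : ∀ a, (∀ b, t (a * b) = 0) → a = 0) {x : R}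
    (hx : contract f t 1 * x = 0) : x = 0 := by
  have h₀ : ((1 : R) ⊗ₜ[k] x) * f = 0 := by
    refine TensorProduct.eq_zero_of_forall_lTensor_eq_zero
      (fun y : R => t ∘ₗ LinearMap.mulLeft k y) (fun b hb => hnd b fun y => ?_) _ fun y => ?_
    · rw [ht]; exact hb y
    · change contract _ t y = 0
      rw [contract_eq_rid, ← mul_assoc, Algebra.TensorProduct.tmul_mul_tmul, mul_one,
        ← contract_eq_rid, hf.contract_eq_mul, ← mul_assoc, hf.contract_one_comm ht, mul_assoc, hx,
        mul_zero]
  have h₁ : ∀ s : R ⊗[k] R, LinearMap.mul' k R (TensorProduct.comm k R R (((1 : R) ⊗ₜ[k] x) * s)) =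
      x * LinearMap.mul' k R (TensorProduct.comm k R R s) := by
    intro s
    induction s with
    | zero => simp
    | add s s' hs hs' => simp only [map_add, mul_add, hs, hs']
    | tmul a b => simp [mul_assoc]
  have h₂ := h₁ f
  rwa [h₀, hf.mul'_comm, map_zero, map_zero, mul_one, eq_comm] at h₂

/-- The finitely many scalars `t(v qᵢ)` determine `f₁ t(v f₂)`, hence `v`. -/
theorem finiteDimensional (hf : IsSymmetricSeparabilityElement k f) {t : R →ₗ[k] k}
    (ht : ∀ a b, t (a * b) = t (b * a)) (hnd : ∀ a, (∀ b, t (a * b) = 0) → a = 0) :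
    FiniteDimensional k R := by
  obtain ⟨n, p, q, h⟩ := TensorProduct.exists_sum_tmul_eq f
  let F : R →ₗ[k] (Fin n → k) := LinearMap.pi fun i => t ∘ₗ LinearMap.mulRight k (q i)
  refine FiniteDimensional.of_injective F ((injective_iff_map_eq_zero F).2 fun v hv => ?_)
  apply hf.eq_zero_of_contract_mul_eq_zero ht hnd
  rw [← hf.contract_eq_mul, h, contract]
  have hv' : ∀ i, t (v * q i) = 0 := fun i => congrFun hv i
  simp [hv']

theorem exists_unit_contract (hf : IsSymmetricSeparabilityElement k f) {t : R →ₗ[k] k}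
    (ht : ∀ a b, t (a * b) = t (b * a)) (hnd : ∀ a, (∀ b, t (a * b) = 0) → a = 0) :
    ∃ w : Rˣ, ((w⁻¹ : Rˣ) : R) = contract f t 1 ∧ (∀ v : R, ↑w * v = v * w) ∧
      ∀ v, contract f t (v * w) = v := by
  have := hf.finiteDimensional ht hnd
  have hinj : Function.Injective (LinearMap.mulLeft k (contract f t 1)) :=
    (injective_iff_map_eq_zero _).2 fun x hx => hf.eq_zero_of_contract_mul_eq_zero ht hnd hx
  obtain ⟨w, hw⟩ := LinearMap.injective_iff_surjective.mp hinj 1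
  rw [LinearMap.mulLeft_apply] at hw
  have hw' : w * contract f t 1 = 1 := by rw [← hf.contract_one_comm ht, hw]
  refine ⟨⟨w, contract f t 1, hw', hw⟩, rfl, fun v => ?_, fun v => ?_⟩
  · calc w * v = w * (v * (contract f t 1 * w)) := by rw [hw, mul_one]
      _ = w * contract f t 1 * (v * w) := by
        rw [← mul_assoc v, ← hf.contract_one_comm ht, mul_assoc, mul_assoc]
      _ = v * w := by rw [hw', one_mul]
  · change contract f t (v * w) = v
    rw [hf.contract_eq_mul, ← mul_assoc, hf.contract_one_comm ht, mul_assoc, hw, mul_one]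

end IsSymmetricSeparabilityElement

/-! ### The Jones tower of a strongly separable extension -/

namespace StronglySeparable

open BasicConstruction (incl)

variable {k N M : Type*} [Field k] [Ring N] [Ring M] [Algebra k N] [Algebra k M]
variable {ι : N →ₐ[k] M} (D : StronglySeparable k ι)

theorem eq_of_forall_E_mul {y z : M} (h : ∀ x, D.E (x * y) = D.E (x * z)) : y = z := by
  rw [← D.dual_right y, ← D.dual_right z]
  simp_rw [h]

theorem mul_jones (x : D.M₁) : x * D.e₁ = D.ι₁ (x 1) * D.e₁ := by
  apply BasicConstruction.ext
  intro m
  have := x.apply_mul 1 (D.E m)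
  simpa using this

theorem condExp_mul_jones (x : D.M₁) : D.condExp (x * D.e₁) = D.lam • x 1 := by
  rw [mul_jones]
  simpa using D.condExp_mul_jones_mul (x 1) 1

/-- `T ∘ E ∘ E_M` is a trace on `M₁`. -/
theorem T₁_comm {T : N →ₗ[k] k} (hT : ∀ n n', T (n * n') = T (n' * n))
    (hTE : ∀ m m', T (D.E (m * m')) = T (D.E (m' * m))) (f g : D.M₁) :
    D.T₁ T (f * g) = D.T₁ T (g * f) := by
  -- Since `M₁ = M e₁ M`, these products suffice, and exchanging the factors only swaps the two
  -- arguments of `T`.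
  have key : ∀ m m' n n' : M, D.T₁ T (D.ι₁ m * D.e₁ * D.ι₁ m' * (D.ι₁ n * D.e₁ * D.ι₁ n')) =
      D.lam • T (D.E (n' * m) * D.E (m' * n)) := by
    intro m m' n n'
    have h : D.ι₁ m * D.e₁ * D.ι₁ m' * (D.ι₁ n * D.e₁ * D.ι₁ n') =
        D.ι₁ m * D.e₁ * D.ι₁ (ι (D.E (m' * n)) * n') := by
      have := D.jones_mul_incl_mul_jones (m' * n)
      rw [map_mul] at this
      calc _ = D.ι₁ m * (D.e₁ * (D.ι₁ m' * D.ι₁ n) * D.e₁) * D.ι₁ n' := by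
            simp only [mul_assoc]
        _ = _ := by rw [this, map_mul (incl ι) (ι _)]; simp only [mul_assoc]
    rw [h]
    change T (D.E (D.condExp _)) = _
    rw [condExp_mul_jones_mul, map_smul, map_smul, hTE, mul_assoc, D.E_mul_left, hT]
  rw [D.eq_sum_jones f, D.eq_sum_jones g]
  simp only [Finset.sum_mul, Finset.mul_sum, map_sum, key]
  rw [Finset.sum_comm]
  refine Finset.sum_congr rfl fun i _ => Finset.sum_congr rfl fun j _ => ?_
  rw [hT]

theorem T₁_mul_jones (T : N →ₗ[k] k) (x : D.M₁) : D.T₁ T (x * D.e₁) = D.lam • D.T₀ T (x 1) := by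
  change T (D.E (D.condExp _)) = D.lam • T (D.E _)
  rw [condExp_mul_jones, map_smul, map_smul]

/-! #### Centralizers -/

theorem mem_U {u : M} : u ∈ D.U ↔ ∀ n, ι n * u = u * ι n := by
  simp [Subalgebra.mem_centralizer_iff]

theorem mem_V {v : D.M₁} : v ∈ D.V ↔ ∀ m, D.ι₁ m * v = v * D.ι₁ m := by
  simp [Subalgebra.mem_centralizer_iff]

theorem mem_A {a : D.M₁} : a ∈ D.A ↔ ∀ n, D.ι₁ (ι n) * a = a * D.ι₁ (ι n) := by
  simp [Subalgebra.mem_centralizer_iff]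

theorem mem_B {b : D.M₂} : b ∈ D.B ↔ ∀ m x, b (D.ι₁ m * x) = D.ι₁ m * b x := by
  rw [Subalgebra.mem_centralizer_iff]
  constructor
  · intro h m x
    exact (DFunLike.congr_fun (h _ ⟨m, rfl⟩) x).symm
  · rintro h _ ⟨m, rfl⟩
    exact BasicConstruction.ext fun x => (h m x).symm

theorem apply_mul_incl (b : D.M₂) (x : D.M₁) (m : M) : b (x * D.ι₁ m) = b x * D.ι₁ m :=
  b.apply_mul x m

theorem V_le_A : D.V ≤ D.A := fun _ hv => D.mem_A.2 fun n => D.mem_V.1 hv (ι n)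

theorem jones_mem_A : D.e₁ ∈ D.A := D.mem_A.2 fun n => BasicConstruction.ext fun m => by
  simp [D.E_mul_left]

theorem incl_mem_A {u : M} (hu : u ∈ D.U) : D.ι₁ u ∈ D.A := D.mem_A.2 fun n => by
  rw [← map_mul, ← map_mul, D.mem_U.1 hu]

theorem condExp_mem_U {a : D.M₁} (ha : a ∈ D.A) : D.condExp a ∈ D.U := D.mem_U.2 fun n => by
  rw [← condExp_mul_left, ← condExp_mul_right, D.mem_A.1 ha]

theorem apply_one_mem_U {a : D.M₁} (ha : a ∈ D.A) : a 1 ∈ D.U := D.mem_U.2 fun n => by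
  have h := DFunLike.congr_fun (D.mem_A.1 ha n) 1
  simp only [BasicConstruction.mul_apply, BasicConstruction.incl_apply, mul_one] at h
  rw [h]
  simpa using a.apply_mul 1 n

theorem apply_mem_A {b : D.M₂} (hb : b ∈ D.B) {a : D.M₁} (ha : a ∈ D.A) : b a ∈ D.A :=
  D.mem_A.2 fun n => by
    rw [← D.mem_B.1 hb, D.mem_A.1 ha, apply_mul_incl]

theorem apply_mem_V {b : D.M₂} (hb : b ∈ D.B) {v : D.M₁} (hv : v ∈ D.V) : b v ∈ D.V :=
  D.mem_V.2 fun m => by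
    rw [← D.mem_B.1 hb, D.mem_V.1 hv, apply_mul_incl]

theorem V_apply {v : D.M₁} (hv : v ∈ D.V) (m : M) : v m = m * v 1 := by
  simpa using (DFunLike.congr_fun (D.mem_V.1 hv m) 1).symm

/-- Right multiplication by an element of `U`, as an element of `V`. -/
def rmul : D.U →ₗ[k] D.V where
  toFun u := ⟨⟨LinearMap.mulRight k u, fun m n => by
      simp [mul_assoc, D.mem_U.1 u.2]⟩, D.mem_V.2 fun m => BasicConstruction.ext fun m' =>
        (mul_assoc m m' u).symm⟩
  map_add' u u' := Subtype.ext <| BasicConstruction.ext fun m => mul_add m _ _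
  map_smul' c u := Subtype.ext <| BasicConstruction.ext fun m => mul_smul_comm c m _

@[simp] theorem rmul_apply (u : D.U) (m : M) : (D.rmul u : D.M₁) m = m * u := rfl

theorem rmul_mul (u u' : D.U) : D.rmul (u * u') = D.rmul u' * D.rmul u :=
  Subtype.ext <| BasicConstruction.ext fun m => (mul_assoc m (u : M) u').symm

theorem rmul_one : D.rmul 1 = 1 := Subtype.ext <| BasicConstruction.ext fun m => mul_one m

theorem rmul_apply_one {v : D.M₁} (hv : v ∈ D.V) :
    D.rmul ⟨v 1, D.apply_one_mem_U (D.V_le_A hv)⟩ = ⟨v, hv⟩ :=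
  Subtype.ext <| BasicConstruction.ext fun m => (D.V_apply hv m).symm

theorem rmul_surjective : Function.Surjective D.rmul := fun v => ⟨_, D.rmul_apply_one v.2⟩

theorem rmul_injective : Function.Injective D.rmul := fun u u' h => Subtype.ext <| by
  simpa using DFunLike.congr_fun (congrArg Subtype.val h) (1 : M)

theorem phi_eq_rmul (u : D.U) : D.phi u = D.rmul u := by
  apply BasicConstruction.ext
  intro m
  conv_rhs => rw [rmul_apply, ← D.dual_right m, Finset.sum_mul]
  simp only [phi, BasicConstruction.sum_apply]
  refine Finset.sum_congr rfl fun i _ => ?_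
  simp [mul_assoc, D.mem_U.1 u.2]

/-- The second alternative is this identity itself. Under the first, `T₁(φ(u)) = λ T₀(∑ xᵢ u yᵢ) = λ
T₀(∑ yᵢ xᵢ u) = T₀(u)`. -/
theorem T₁_rmul {T : N →ₗ[k] k} (hMarkov : D.IsSymmetricMarkov T)
    (hProd : D.SymmetricProduct ∨ ∀ u ∈ D.U, D.T₁ T (D.phi u) = D.T₀ T u) (u : D.U) :
    D.T₁ T (D.rmul u) = D.T₀ T u := by
  rw [← phi_eq_rmul]
  rcases hProd with h | h
  · change T (D.E (D.condExp _)) = T (D.E _)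
    simp only [phi, map_sum, condExp_mul_jones_mul, map_smul]
    have : ∀ i, T (D.E (D.x i * u * D.y i)) = T (D.E (D.y i * D.x i * u)) := fun i => by
      rw [hMarkov.trace_E, mul_assoc]
    simp_rw [this]
    rw [← Finset.smul_sum, ← map_sum, ← map_sum, ← Finset.sum_mul, h, smul_mul_assoc, one_mul,
      map_smul, map_smul, smul_smul, mul_inv_cancel₀ D.lam_ne_zero, one_smul]
  · exact h u u.2

theorem T₁_V {T : N →ₗ[k] k} (hMarkov : D.IsSymmetricMarkov T)
    (hProd : D.SymmetricProduct ∨ ∀ u ∈ D.U, D.T₁ T (D.phi u) = D.T₀ T u) {v : D.M₁}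
    (hv : v ∈ D.V) : D.T₁ T v = D.T₀ T (v 1) := by
  rw [← D.T₁_rmul hMarkov hProd ⟨v 1, D.apply_one_mem_U (D.V_le_A hv)⟩, D.rmul_apply_one hv]

theorem T₀_comm {T : N →ₗ[k] k} (hMarkov : D.IsSymmetricMarkov T) (m m' : M) :
    D.T₀ T (m * m') = D.T₀ T (m' * m) := hMarkov.trace_E m m'

theorem T₁_comm' {T : N →ₗ[k] k} (hMarkov : D.IsSymmetricMarkov T) (f g : D.M₁) :
    D.T₁ T (f * g) = D.T₁ T (g * f) := D.T₁_comm hMarkov.trace hMarkov.trace_E f g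

theorem T₂_comm {T : N →ₗ[k] k} (hMarkov : D.IsSymmetricMarkov T) (f g : D.M₂) :
    D.T₂ T (f * g) = D.T₂ T (g * f) :=
  D.next.T₁_comm (T := D.T₀ T) hMarkov.trace_E (D.T₁_comm' hMarkov) f g

theorem T₂_mul_jones (T : N →ₗ[k] k) (x : D.M₂) : D.T₂ T (x * D.e₂) = D.lam • D.T₁ T (x 1) :=
  D.next.T₁_mul_jones (D.T₀ T) x

end StronglySeparable

namespace StronglySeparable

open BasicConstruction (incl)

variable {k N M : Type*} [Field k] [Ring N] [Ring M] [Algebra k N] [Algebra k M]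
variable {ι : N →ₐ[k] M} (D : StronglySeparable k ι)

/-! #### The action of `B` on `A` -/

/-- `B` acts on `A` by evaluation. -/
def actA : D.B →ₐ[k] Module.End k D.A where
  toFun b :=
    { toFun := fun a => ⟨(b : D.M₂) a, D.apply_mem_A b.2 a.2⟩
      map_add' := fun _ _ => Subtype.ext (map_add (BasicConstruction.val (incl ι) (b : D.M₂)) _ _)
      map_smul' := fun c _ =>
        Subtype.ext (map_smul (BasicConstruction.val (incl ι) (b : D.M₂)) c _) }
  map_one' := rfl
  map_mul' _ _ := rfl
  map_zero' := rfl
  map_add' _ _ := rfl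
  commutes' _ := rfl

@[simp] theorem coe_actA (b : D.B) (a : D.A) : (D.actA b a : D.M₁) = (b : D.M₂) a := rfl

/-- Left multiplication by an element of `V`, as an element of `B`. -/
def leftB : D.V →ₗ[k] D.B where
  toFun v := ⟨D.ι₂ v, D.mem_B.2 fun m x => by
    simp only [BasicConstruction.incl_apply]
    rw [← mul_assoc, ← mul_assoc, D.mem_V.1 v.2]⟩
  map_add' v v' := Subtype.ext (map_add (D.ι₂) _ _)
  map_smul' c v := Subtype.ext (map_smul (D.ι₂) c _)

/-- Right multiplication by an element of `V`, as an element of `B`. -/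
def rightB : D.V →ₗ[k] D.B where
  toFun v := ⟨⟨LinearMap.mulRight k (v : D.M₁), fun x m => by
    simp only [LinearMap.mulRight_apply]
    rw [mul_assoc, mul_assoc, D.mem_V.1 v.2]⟩, D.mem_B.2 fun m x => mul_assoc _ x _⟩
  map_add' v v' := Subtype.ext <| BasicConstruction.ext fun x => mul_add x _ _
  map_smul' c v := Subtype.ext <| BasicConstruction.ext fun x => mul_smul_comm c x _

/-- The second Jones idempotent as an element of `B`. -/
def jonesB : D.B := ⟨D.e₂, D.mem_B.2 fun m x => by
  rw [jones_apply, jones_apply, D.next.E_mul_left, map_mul]⟩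

@[simp] theorem jonesB_apply (x : D.M₁) : (D.jonesB : D.M₂) x = D.ι₁ (D.condExp x) := rfl

theorem ext_E {y z : D.M₁} (h : ∀ x, D.condExp (x * y) = D.condExp (x * z)) : y = z :=
  D.next.eq_of_forall_E_mul h

/-- An explicit transpose of `b` for `E_M`: expand `x` in the dual bases of `M₁ / M` and use left
`M`-linearity of `b`. -/
theorem condExp_apply_mul (b : D.M₂) (hb : b ∈ D.B) (x y : D.M₁) :
    D.condExp (b x * y) =
      D.condExp (x * ∑ i, D.next.x i * D.ι₁ (D.condExp (b (D.next.y i) * y))) := by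
  have h : ∑ i, D.ι₁ (D.condExp (x * D.next.x i)) * D.next.y i = x := D.next.dual_left x
  conv_lhs => rw [← h]
  rw [BasicConstruction.map_sum_apply]
  simp only [D.mem_B.1 hb, Finset.sum_mul, Finset.mul_sum, map_sum]
  refine Finset.sum_congr rfl fun i _ => ?_
  rw [mul_assoc, condExp_mul_left, ← mul_assoc, condExp_mul_right]

theorem exists_transpose (b : D.M₂) (hb : b ∈ D.B) :
    ∃ b' ∈ D.B, ∀ x y, D.condExp (b x * y) = D.condExp (x * b' y) := by
  let F : D.M₁ →ₗ[k] D.M₁ :=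
    { toFun := fun y => ∑ i, D.next.x i * D.ι₁ (D.condExp (b (D.next.y i) * y))
      map_add' := fun y y' => by
        simp only [mul_add, map_add, Finset.sum_add_distrib]
      map_smul' := fun c y => by
        simp only [mul_smul_comm, map_smul, Finset.smul_sum, RingHom.id_apply] }
  have hF : ∀ x y, D.condExp (b x * y) = D.condExp (x * F y) := D.condExp_apply_mul b hb
  refine ⟨⟨F, fun y m => D.ext_E fun x => ?_⟩, D.mem_B.2 fun m y => D.ext_E fun x => ?_, hF⟩
  · rw [← hF, ← mul_assoc, ← mul_assoc, condExp_mul_right, condExp_mul_right, hF]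
  · change D.condExp (x * F _) = D.condExp (x * (_ * F y))
    rw [← hF, ← mul_assoc, ← mul_assoc, ← hF, apply_mul_incl]

theorem T₁_incl_mul (T : N →ₗ[k] k) (m : M) (x : D.M₁) :
    D.T₁ T (D.ι₁ m * x) = D.T₀ T (m * D.condExp x) := by
  change D.T₀ T (D.condExp _) = _
  rw [condExp_mul_left]

theorem T₁_mul_incl (T : N →ₗ[k] k) (m : M) (x : D.M₁) :
    D.T₁ T (x * D.ι₁ m) = D.T₀ T (D.condExp x * m) := by
  change D.T₀ T (D.condExp _) = _
  rw [condExp_mul_right]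

/-- The coefficients `E_M(a zᵢ)` of `a` in dual bases from `A` lie in `U`, where `T₀` is
nondegenerate. -/
theorem eq_zero_of_T₁_mul {T : N →ₗ[k] k} (hWeak : D.WeaklyIrreducible T) (hDepth : D.DepthTwo)
    {a : D.M₁} (ha : a ∈ D.A) (h : ∀ a' ∈ D.A, D.T₁ T (a * a') = 0) : a = 0 := by
  obtain ⟨s, z, y, hz, hy, hzy, -⟩ := hDepth.1
  rw [← hzy a]
  refine Finset.sum_eq_zero fun i _ => ?_
  have : D.next.E (a * z i) = 0 := by
    refine hWeak.2 _ (D.condExp_mem_U (D.A.mul_mem ha (hz i))) fun u hu => ?_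
    change D.T₀ T (D.condExp _ * u) = 0
    rw [← T₁_mul_incl, mul_assoc]
    exact h _ (D.A.mul_mem (hz i) (D.incl_mem_A hu))
  rw [this, map_zero, zero_mul]

/-- Dual bases in `B` extend the vanishing from `B` to all of `M₂`; the elements `e₂ x` then give
`E_M(x a) = 0`. -/
theorem eq_zero_of_forall_apply_one {a : D.M₁} (hDepth : D.DepthTwo)
    (h : ∀ b ∈ D.B, (b a) 1 = 0) : a = 0 := by
  obtain ⟨s, u, v, hu, hv, huv, -⟩ := hDepth.2
  have hf : ∀ f : D.M₂, (f a) 1 = 0 := fun f => by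
    rw [← huv f, BasicConstruction.sum_apply, BasicConstruction.sum_apply]
    refine Finset.sum_eq_zero fun i _ => ?_
    rw [BasicConstruction.mul_apply, BasicConstruction.incl_apply, BasicConstruction.mul_apply,
      h _ (hv i)]
    exact map_zero (BasicConstruction.val ι _)
  refine D.ext_E fun x => ?_
  have := hf (D.e₂ * D.ι₂ x)
  rw [BasicConstruction.mul_apply, jones_apply, BasicConstruction.incl_apply,
    BasicConstruction.incl_apply, mul_one] at this
  rw [mul_zero, map_zero]
  exact this

theorem eq_zero_of_forall_mem_A {b : D.M₂} (hb : b ∈ D.B) (hDepth : D.DepthTwo)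
    (h : ∀ a ∈ D.A, (b a) 1 = 0) : b = 0 := by
  obtain ⟨s, z, y, hz, hy, hzy, -⟩ := hDepth.1
  have h₁ : ∀ x, (b x) 1 = 0 := fun x => by
    rw [← hzy x, BasicConstruction.map_sum_apply, BasicConstruction.sum_apply]
    refine Finset.sum_eq_zero fun i _ => ?_
    rw [D.mem_B.1 hb, BasicConstruction.mul_apply, h _ (hy i)]
    exact map_zero (BasicConstruction.val ι _)
  refine BasicConstruction.ext fun x => BasicConstruction.ext fun m => ?_
  have := h₁ (x * D.ι₁ m)
  rw [apply_mul_incl, BasicConstruction.mul_apply, BasicConstruction.incl_apply, mul_one] at this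
  exact this

/-- Elements of `B` are `M`-bimodule maps, and `e₁` generates `M₁` as an `M`-bimodule. -/
theorem eq_of_apply_jones {b c : D.M₂} (hb : b ∈ D.B) (hc : c ∈ D.B) (h : b D.e₁ = c D.e₁) :
    b = c := by
  refine BasicConstruction.ext fun x => ?_
  rw [D.eq_sum_jones x, BasicConstruction.map_sum_apply, BasicConstruction.map_sum_apply]
  refine Finset.sum_congr rfl fun i _ => ?_
  rw [apply_mul_incl, apply_mul_incl, D.mem_B.1 hb, D.mem_B.1 hc, h]

theorem exists_leibniz (hDepth : D.DepthTwo) (b : D.B) :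
    ∃ t : D.B ⊗[k] D.B, ∀ x y : D.A, LinearMap.mul' k D.A (TensorProduct.map
      (D.actA.toLinearMap.flip x) (D.actA.toLinearMap.flip y) t) = D.actA b (x * y) := by
  obtain ⟨s, u, v, hu, hv, huv, -⟩ := hDepth.2
  have hcomm : ∀ c ∈ D.B, ∀ m, D.ι₂ (D.ι₁ m) * c = c * D.ι₂ (D.ι₁ m) := fun c hc m => by
    rw [Subalgebra.mem_centralizer_iff] at hc
    exact hc _ ⟨m, rfl⟩
  -- In `M₂`, `b x = ∑ E_{M₁}(b x uᵢ) vᵢ`. Evaluating at `y` gives `b(xy) = ∑ Fᵢ(x) vᵢ(y)`, and each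
  -- `Fᵢ` is an `M`-bimodule map, hence in `B`.
  let F : Fin s → D.M₁ →ₗ[k] D.M₁ := fun i =>
    { toFun := fun x => D.next.next.E ((b : D.M₂) * D.ι₂ x * u i)
      map_add' := fun x x' => by simp only [map_add, mul_add, add_mul]
      map_smul' := fun c x => by
        simp only [map_smul, mul_smul_comm, smul_mul_assoc, RingHom.id_apply] }
  have hF : ∀ i x, F i x = D.next.next.E ((b : D.M₂) * D.ι₂ x * u i) := fun _ _ => rfl
  let β : Fin s → D.B := fun i => ⟨⟨F i, fun x m => by
    rw [hF, hF, ← D.next.next.E_mul_right, map_mul D.ι₂, mul_assoc _ (u i),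
      ← hcomm _ (hu i)]
    simp only [mul_assoc]⟩, D.mem_B.2 fun m x => by
      change F i _ = _ * F i x
      rw [hF, hF, ← D.next.next.E_mul_left, map_mul D.ι₂, ← mul_assoc, ← hcomm _ b.2]
      simp only [mul_assoc]⟩
  refine ⟨∑ i, β i ⊗ₜ ⟨v i, hv i⟩, fun x y => Subtype.ext ?_⟩
  have h := DFunLike.congr_fun (huv ((b : D.M₂) * D.ι₂ (x : D.M₁))) (y : D.M₁)
  rw [BasicConstruction.sum_apply] at h
  rw [coe_actA]
  refine Eq.trans ?_ h
  simp only [map_sum, TensorProduct.map_tmul, LinearMap.mul'_apply, AddSubmonoidClass.coe_finsetSum]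
  rfl

/-! #### The functional `κ` -/

/-- The functional `κ(a) = λ⁻¹ T₁(e₁ w a)` on `A`, see `T₁_jones_mul`. -/
def kappa (T : N →ₗ[k] k) (w : D.V) : D.A →ₗ[k] k where
  toFun a := D.T₀ T ((w * (a : D.M₁)) 1)
  map_add' a a' := by
    rw [Subalgebra.coe_add, mul_add, BasicConstruction.add_apply, map_add]
  map_smul' c a := by
    rw [Subalgebra.coe_smul, mul_smul_comm, BasicConstruction.smul_apply, map_smul]
    rfl

theorem kappa_apply (T : N →ₗ[k] k) (w : D.V) (a : D.A) :
    D.kappa T w a = D.T₀ T ((w : D.M₁) ((a : D.M₁) 1)) := rfl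

theorem T₁_jones_mul {T : N →ₗ[k] k} (hMarkov : D.IsSymmetricMarkov T) (x : D.M₁) :
    D.T₁ T (D.e₁ * x) = D.lam • D.T₀ T (x 1) := by
  rw [D.T₁_comm' hMarkov, T₁_mul_jones]

theorem pairing_eq_kappa {T : N →ₗ[k] k} (hMarkov : D.IsSymmetricMarkov T) (w : D.V) (a : D.A)
    (b : D.B) : D.pairing T w a b = D.kappa T w (D.actA b a) := by
  change D.lam⁻¹ ^ 2 • D.T₂ T _ = _
  have h : D.T₂ T (D.ι₂ a * D.e₂ * D.ι₂ D.e₁ * D.ι₂ w * b) =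
      D.T₂ T (D.ι₂ D.e₁ * D.ι₂ w * b * D.ι₂ a * D.e₂) := by
    rw [mul_assoc, mul_assoc, D.T₂_comm hMarkov, ← mul_assoc, ← mul_assoc, mul_assoc (D.ι₂ D.e₁)]
  rw [h, T₂_mul_jones]
  have h' : (D.ι₂ D.e₁ * D.ι₂ w * b * D.ι₂ a) 1 = D.e₁ * (w * (b : D.M₂) a) := by
    simp
  rw [h', D.T₁_jones_mul hMarkov, smul_smul, smul_smul, pow_two, mul_assoc, mul_assoc,
    ← mul_assoc D.lam⁻¹ D.lam, inv_mul_cancel₀ D.lam_ne_zero, one_mul,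
    inv_mul_cancel₀ D.lam_ne_zero, one_smul]
  rfl

theorem pairing'_eq {T : N →ₗ[k] k} (hMarkov : D.IsSymmetricMarkov T) (w : D.V) (a : D.A)
    (b : D.B) : D.pairing' T w a b = D.lam⁻¹ • D.T₁ T (w * a * (b : D.M₂) D.e₁) := by
  change D.lam⁻¹ ^ 2 • D.T₂ T _ = _
  have h : D.T₂ T (b * D.ι₂ D.e₁ * D.e₂ * D.ι₂ w * D.ι₂ a) =
      D.T₂ T (D.ι₂ w * D.ι₂ a * b * D.ι₂ D.e₁ * D.e₂) := by
    rw [mul_assoc, D.T₂_comm hMarkov]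
    simp only [mul_assoc]
  rw [h, T₂_mul_jones]
  have h' : (D.ι₂ w * D.ι₂ a * b * D.ι₂ D.e₁) 1 = w * a * (b : D.M₂) D.e₁ := by
    simp [mul_assoc]
  rw [h', smul_smul, pow_two, mul_assoc, inv_mul_cancel₀ D.lam_ne_zero, mul_one]

end StronglySeparable

/-! ### Dual bases and nondegeneracy for `κ`, and the datum of the tower. -/

namespace StronglySeparable

open BasicConstruction (incl)

variable {k N M : Type*} [Field k] [Ring N] [Ring M] [Algebra k N] [Algebra k M]
variable {ι : N →ₐ[k] M} (D : StronglySeparable k ι)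

theorem V_mul_apply_one (v : D.V) {y : D.M₁} : ((v : D.M₁) * y) 1 = y 1 * (v : D.M₁) 1 := by
  rw [BasicConstruction.mul_apply, D.V_apply v.2]

/-- `w(1) ∈ U`, as an invertible element of `A`. -/
def unitA (w : (D.V)ˣ) : (D.A)ˣ where
  val := ⟨D.ι₁ (((w : D.V) : D.M₁) 1), D.incl_mem_A (D.apply_one_mem_U (D.V_le_A (w : D.V).2))⟩
  inv := ⟨D.ι₁ (((↑w⁻¹ : D.V) : D.M₁) 1),
    D.incl_mem_A (D.apply_one_mem_U (D.V_le_A (↑w⁻¹ : D.V).2))⟩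
  val_inv := Subtype.ext <| by
    change D.ι₁ _ * D.ι₁ _ = 1
    rw [← map_mul, ← D.V_mul_apply_one, ← Subalgebra.coe_mul, Units.inv_mul]
    simp
  inv_val := Subtype.ext <| by
    change D.ι₁ _ * D.ι₁ _ = 1
    rw [← map_mul, ← D.V_mul_apply_one, ← Subalgebra.coe_mul, Units.mul_inv]
    simp

theorem coe_unitA (w : (D.V)ˣ) : ((D.unitA w : D.A) : D.M₁) = D.ι₁ (((w : D.V) : D.M₁) 1) := rfl

variable {T : N →ₗ[k] k}

theorem kappa_incl (hMarkov : D.IsSymmetricMarkov T)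
    (hProd : D.SymmetricProduct ∨ ∀ u ∈ D.U, D.T₁ T (D.phi u) = D.T₀ T u) (w v : D.V) :
    D.kappa T w (Subalgebra.inclusion D.V_le_A v) = D.T₁ T (w * v : D.V) :=
  (D.T₁_V hMarkov hProd (w * v).2).symm

theorem sum_kappa_smul_left (hMarkov : D.IsSymmetricMarkov T)
    (hProd : D.SymmetricProduct ∨ ∀ u ∈ D.U, D.T₁ T (D.phi u) = D.T₀ T u)
    {n : ℕ} {f₁ f₂ : Fin n → D.V} {f : D.V ⊗[k] D.V} (hff : f = ∑ i, f₁ i ⊗ₜ f₂ i) (w : (D.V)ˣ)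
    (hslice : ∀ v : D.V, D.slice T f (v * w) = v) (v : D.V) :
    ∑ i, D.kappa T w (Subalgebra.inclusion D.V_le_A (f₂ i * v)) • f₁ i = v := by
  conv_rhs => rw [← hslice v, hff, slice]
  simp only [map_sum, LinearMap.lTensor_tmul, TensorProduct.rid_tmul]
  refine Finset.sum_congr rfl fun i _ => ?_
  rw [D.kappa_incl hMarkov hProd]
  congr 1
  change D.T₁ T (((w : D.V) : D.M₁) * (f₂ i * v)) = D.T₁ T (v * (w : D.V) * f₂ i)
  rw [mul_assoc (v : D.M₁), D.T₁_comm' hMarkov (v : D.M₁), mul_assoc]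

theorem sum_kappa_smul_right (hMarkov : D.IsSymmetricMarkov T)
    (hProd : D.SymmetricProduct ∨ ∀ u ∈ D.U, D.T₁ T (D.phi u) = D.T₀ T u)
    {n : ℕ} {f₁ f₂ : Fin n → D.V} {f : D.V ⊗[k] D.V} (hf : IsSymmetricSeparabilityElement k f)
    (hff : f = ∑ i, f₁ i ⊗ₜ f₂ i) (w : (D.V)ˣ) (hw : ∀ v : D.V, ↑w * v = v * w)
    (hslice : ∀ v : D.V, D.slice T f (v * w) = v) (v : D.V) :
    ∑ i, D.kappa T w (Subalgebra.inclusion D.V_le_A (v * f₁ i)) • f₂ i = v := by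
  conv_rhs => rw [← hslice v, ← hf.symm, hff, slice]
  simp only [map_sum, TensorProduct.comm_tmul, LinearMap.lTensor_tmul, TensorProduct.rid_tmul]
  refine Finset.sum_congr rfl fun i _ => ?_
  rw [D.kappa_incl hMarkov hProd, ← hw, ← mul_assoc]
  rfl

theorem kappa_mul (w : D.V) {n : ℕ} {f₁ f₂ : Fin n → D.V}
    (hf : ∀ v : D.V, ∑ i, D.kappa T w (Subalgebra.inclusion D.V_le_A (f₂ i * v)) • f₁ i = v)
    (x y : D.A) :
    ∑ i, D.kappa T w (x * Subalgebra.inclusion D.V_le_A (f₁ i)) *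
      D.kappa T w (Subalgebra.inclusion D.V_le_A (f₂ i) * y) = D.kappa T w (x * y) := by
  -- `κ(a y)` depends on `y` only through `y(1)`, so `y` may be replaced by the element of `V` with
  -- the same value at `1`.
  let v : D.V := D.rmul ⟨(y : D.M₁) 1, D.apply_one_mem_U y.2⟩
  have h : ∀ a : D.A, D.kappa T w (a * y) = D.kappa T w (a * Subalgebra.inclusion D.V_le_A v) := by
    intro a
    rw [kappa_apply, kappa_apply]
    simp [v]
  rw [h]
  conv_rhs => rw [← hf v]
  rw [map_sum, Finset.mul_sum, map_sum]
  refine Finset.sum_congr rfl fun i _ => ?_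
  rw [map_smul, mul_smul_comm, map_smul, smul_eq_mul, mul_comm, h,
    map_mul (Subalgebra.inclusion D.V_le_A)]

theorem kappa_jonesB (hMarkov : D.IsSymmetricMarkov T) (w : (D.V)ˣ) (a : D.A) :
    D.kappa T w (D.actA D.jonesB a) = D.T₁ T ((D.unitA w * a : D.A) : D.M₁) := by
  rw [Subalgebra.coe_mul, coe_unitA, T₁_incl_mul, kappa_apply, coe_actA, jonesB_apply,
    BasicConstruction.incl_apply, mul_one, D.V_apply (w : D.V).2, D.T₀_comm hMarkov]

theorem eq_zero_of_kappa_left (hWeak : D.WeaklyIrreducible T) (hDepth : D.DepthTwo) (w : (D.V)ˣ)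
    (a : D.A) (h : ∀ b, D.kappa T w (D.actA b a) = 0) : a = 0 := by
  refine Subtype.ext (D.eq_zero_of_forall_apply_one hDepth fun b hb => ?_)
  refine hWeak.2 _ (D.apply_one_mem_U (D.apply_mem_A hb a.2)) fun u hu => ?_
  -- This element of `B` cancels `w` and leaves `T₀(b(a)(1) u)`.
  have := h (D.leftB (↑w⁻¹ * D.rmul ⟨u, hu⟩) * ⟨b, hb⟩)
  rw [kappa_apply, ← BasicConstruction.mul_apply] at this
  change D.T₀ T (((w : D.V) * (((↑w⁻¹ * D.rmul ⟨u, hu⟩ : D.V) : D.M₁) * b a)) 1) = 0 at this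
  rw [← mul_assoc, ← Subalgebra.coe_mul, ← mul_assoc, Units.mul_inv, one_mul,
    D.V_mul_apply_one, rmul_apply, one_mul] at this
  exact this

theorem eq_zero_of_kappa_right (hMarkov : D.IsSymmetricMarkov T) (hWeak : D.WeaklyIrreducible T)
    (hDepth : D.DepthTwo) (w : (D.V)ˣ) (b : D.B) (h : ∀ a, D.kappa T w (D.actA b a) = 0) :
    b = 0 := by
  refine Subtype.ext (D.eq_zero_of_forall_mem_A b.2 hDepth fun a ha => ?_)
  have h₁ : (((w : D.V) : D.M₁) * (b : D.M₂) a) 1 = 0 := by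
    refine hWeak.2 _ (D.apply_one_mem_U (D.A.mul_mem (D.V_le_A (w : D.V).2)
      (D.apply_mem_A b.2 ha))) fun u hu => ?_
    -- Both `b` and `w` commute with left multiplication by `u`, so testing on `u a` gives `T₀(u ·
    -- (w b(a))(1))`.
    have := h ⟨D.ι₁ u * a, D.A.mul_mem (D.incl_mem_A hu) ha⟩
    rw [kappa_apply, ← BasicConstruction.mul_apply, coe_actA] at this
    change D.T₀ T ((((w : D.V) : D.M₁) * (b : D.M₂) (D.ι₁ u * a)) 1) = 0 at this
    rw [D.mem_B.1 b.2, ← mul_assoc, ← D.mem_V.1 (w : D.V).2, mul_assoc,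
      BasicConstruction.mul_apply, BasicConstruction.incl_apply, D.T₀_comm hMarkov] at this
    exact this
  have h₂ : (b : D.M₂) a = ((↑w⁻¹ : D.V) : D.M₁) * (((w : D.V) : D.M₁) * (b : D.M₂) a) := by
    rw [← mul_assoc, ← Subalgebra.coe_mul, Units.inv_mul, Subalgebra.coe_one, one_mul]
  rw [h₂, BasicConstruction.mul_apply, h₁]
  exact map_zero (BasicConstruction.val ι _)

/-! #### The weak Hopf algebra `B` -/

/-- The coefficients of `a` in dual bases from `A` embed `A` in a finite power of `U`. -/
theorem finiteDimensional_A (hDepth : D.DepthTwo) [FiniteDimensional k D.U] :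
    FiniteDimensional k D.A := by
  obtain ⟨s, z, y, hz, hy, hzy, -⟩ := hDepth.1
  let F : D.A →ₗ[k] (Fin s → M) := LinearMap.pi fun i =>
    D.condExp ∘ₗ LinearMap.mulRight k (z i) ∘ₗ D.A.val.toLinearMap
  have hF : ∀ a i, F a i ∈ D.U := fun a i => D.condExp_mem_U (D.A.mul_mem a.2 (hz i))
  let F' : D.A →ₗ[k] (Fin s → D.U) := LinearMap.pi fun i =>
    (LinearMap.proj i ∘ₗ F).codRestrict (Subalgebra.toSubmodule D.U) fun a => hF a i
  refine FiniteDimensional.of_injective F' ((injective_iff_map_eq_zero F').2 fun a ha => ?_)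
  refine Subtype.ext ?_
  rw [← hzy a]
  refine Finset.sum_eq_zero fun i _ => ?_
  have : D.next.E ((a : D.M₁) * z i) = 0 := congrArg Subtype.val (congrFun ha i)
  rw [this, map_zero, zero_mul]

theorem finiteDimensional_B [FiniteDimensional k D.A] : FiniteDimensional k D.B := by
  refine FiniteDimensional.of_injective (D.actA.toLinearMap.flip ⟨D.e₁, D.jones_mem_A⟩) ?_
  exact fun b c h => Subtype.ext (D.eq_of_apply_jones b.2 c.2 (congrArg Subtype.val h))

theorem T₁_V_nondegenerate {T : N →ₗ[k] k} (hMarkov : D.IsSymmetricMarkov T)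
    (hProd : D.SymmetricProduct ∨ ∀ u ∈ D.U, D.T₁ T (D.phi u) = D.T₀ T u)
    (hWeak : D.WeaklyIrreducible T) (v : D.V) (h : ∀ v' : D.V, D.T₁ T (v * v' : D.V) = 0) :
    v = 0 := by
  obtain ⟨u, rfl⟩ := D.rmul_surjective v
  have : u = 0 := Subtype.ext <| hWeak.2 _ u.2 fun u' hu' => by
    have := h (D.rmul ⟨u', hu'⟩)
    rwa [← rmul_mul, D.T₁_rmul hMarkov hProd, Subalgebra.coe_mul, D.T₀_comm hMarkov] at this
  rw [this, map_zero]

/-- The algebras `A` and `B` of a weakly irreducible depth 2 extension, for a representation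
`∑ f₁ i ⊗ f₂ i` of the symmetric separability element of `V`. -/
def weakHopfDatum {T : N →ₗ[k] k} (hMarkov : D.IsSymmetricMarkov T)
    (hProd : D.SymmetricProduct ∨ ∀ u ∈ D.U, D.T₁ T (D.phi u) = D.T₀ T u)
    (hWeak : D.WeaklyIrreducible T) (hDepth : D.DepthTwo)
    {n : ℕ} {f₁ f₂ : Fin n → D.V} {f : D.V ⊗[k] D.V} (hf : IsSymmetricSeparabilityElement k f)
    (hff : f = ∑ i, f₁ i ⊗ₜ f₂ i) (w : (D.V)ˣ) (hw : ∀ v : D.V, ↑w * v = v * w)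
    (hslice : ∀ v : D.V, D.slice T f (v * w) = v) : WeakHopfDatum k D.A D.B D.V where
  act := D.actA
  incl := Subalgebra.inclusion D.V_le_A
  left := D.leftB
  right := D.rightB
  act_left _ _ := rfl
  act_right _ _ := rfl
  act_incl b v := ⟨⟨_, D.apply_mem_V b.2 v.2⟩, rfl⟩
  tr := D.T₁ T ∘ₗ D.A.val.toLinearMap
  tr_comm a a' := D.T₁_comm' hMarkov a a'
  tr_nondegenerate a h := Subtype.ext <|
    D.eq_zero_of_T₁_mul hWeak hDepth a.2 fun a' ha' => h ⟨a', ha'⟩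
  transpose b := by
    obtain ⟨b', hb', h⟩ := D.exists_transpose b b.2
    exact ⟨⟨b', hb'⟩, fun x y => congrArg (D.T₀ T) (h x y)⟩
  n := n
  f₁ := f₁
  f₂ := f₂
  w := w
  w_comm := hw
  sum_f₁_mul_f₂ := by simpa [hff] using hf.mul_eq_one
  sum_f₂_mul_f₁ := by simpa [hff] using hf.mul'_comm
  casimir v := by
    have := hf.casimir' v
    simpa [hff, Finset.sum_mul, Finset.mul_sum] using this
  κ := D.kappa T w
  κ_incl v := D.kappa_incl hMarkov hProd w v
  κ_mul x y := D.kappa_mul w (D.sum_kappa_smul_left hMarkov hProd hff w hslice) x y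
  sum_κ_smul_f₁ := D.sum_kappa_smul_left hMarkov hProd hff w hslice
  sum_κ_smul_f₂ := D.sum_kappa_smul_right hMarkov hProd hf hff w hw hslice
  pairing_left := D.eq_zero_of_kappa_left hWeak hDepth w
  pairing_right := D.eq_zero_of_kappa_right hMarkov hWeak hDepth w
  leibniz := D.exists_leibniz hDepth
  E := D.jonesB
  act_E_one := Subtype.ext <| by
    have : D.condExp 1 = 1 := D.next.E_one
    rw [coe_actA, Subalgebra.coe_one, jonesB_apply, this, map_one]
  -- `e₂(x) = E_M(x)` lies in `M`, and `b` is right `M`-linear.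
  act_act_E b x := Subtype.ext <| by
    rw [coe_actA, Subalgebra.coe_mul, coe_actA, coe_actA, jonesB_apply, Subalgebra.coe_one,
      ← apply_mul_incl, one_mul]
  q := D.unitA w
  κ_act_E := D.kappa_jonesB hMarkov w
  act_q_mul b a := Subtype.ext <| by
    rw [coe_actA, Subalgebra.coe_mul, coe_unitA, D.mem_B.1 b.2]
    rfl

end StronglySeparable

theorem mainTheorem3 {k N M : Type*} [Field k] [Ring N] [Ring M] [Algebra k N] [Algebra k M]
    (ι : N →ₐ[k] M) (D : StronglySeparable k ι) (T : N →ₗ[k] k)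
    (hMarkov : D.IsSymmetricMarkov T)
    (hProd : D.SymmetricProduct ∨ ∀ u ∈ D.U, D.T₁ T (D.phi u) = D.T₀ T u)
    (hWeak : D.WeaklyIrreducible T)
    (hDepth : D.DepthTwo) :
    ∃ f : D.V ⊗[k] D.V, (∀ f', IsSymmetricSeparabilityElement k f' ↔ f' = f) ∧
    ∃ w : (D.V)ˣ, ((w⁻¹ : (D.V)ˣ) : D.V) = D.slice T f 1 ∧
      (w : D.V) ∈ Subalgebra.center k D.V ∧
      (∀ v : D.V, D.slice T f (v * w) = v) ∧
      (D.pairing T w).Nondegenerate ∧ (D.pairing' T w).Nondegenerate ∧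
      ∃ H : WeakHopfAlgebra k D.B,
        (∀ (Δ : D.B →ₗ[k] D.B ⊗[k] D.B) (ε : D.B →ₗ[k] k) (S : D.B →ₗ[k] D.B),
          D.IsDualStructure T w Δ ε S ↔
            Δ = H.comul ∧ ε = H.counit ∧ S = H.antipode) ∧
        Function.Bijective H.antipode ∧
        IsSemisimpleRing D.B := by
  obtain ⟨g, hg⟩ := hWeak.1
  have hf := hg.map_anti D.rmul D.rmul_mul D.rmul_one D.rmul_surjective
  generalize TensorProduct.map D.rmul D.rmul g = f at hf
  have ht : ∀ v v' : D.V, (D.T₁ T ∘ₗ D.V.val.toLinearMap) (v * v') =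
      (D.T₁ T ∘ₗ D.V.val.toLinearMap) (v' * v) := fun v v' => D.T₁_comm' hMarkov v v'
  have hnd : ∀ v : D.V, (∀ v', (D.T₁ T ∘ₗ D.V.val.toLinearMap) (v * v') = 0) → v = 0 :=
    D.T₁_V_nondegenerate hMarkov hProd hWeak
  obtain ⟨w, hw₁, hw₂, hw₃⟩ := hf.exists_unit_contract ht hnd
  obtain ⟨n, f₁, f₂, hff⟩ := TensorProduct.exists_sum_tmul_eq f
  have := hf.finiteDimensional ht hnd
  have : FiniteDimensional k D.U := FiniteDimensional.of_injective D.rmul D.rmul_injective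
  have := D.finiteDimensional_A hDepth
  have := D.finiteDimensional_B
  let H := D.weakHopfDatum hMarkov hProd hWeak hDepth hf hff w hw₂ hw₃
  have hpair : ∀ a b, D.pairing T w a b = H.κ (H.act b a) := D.pairing_eq_kappa hMarkov w
  have hpair' : ∀ a, D.pairing T w a = H.pair a := fun a => LinearMap.ext (hpair a)
  have hS : ∀ a b, D.pairing' T w a (H.antipode b) = D.pairing T w a b := fun a b => by
    rw [D.pairing'_eq hMarkov, D.pairing_eq_kappa hMarkov, D.kappa_apply,
      ← BasicConstruction.mul_apply, D.coe_actA]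
    -- The primed pairing is `λ⁻¹ T₁(w a b(e₁))`, so the antipode is tested at `e₁`; then `T₁(e₁ x)
    -- = λ T₀(x(1))` recovers `κ`.
    have h := H.tr_mul_act_antipode a ⟨D.e₁, D.jones_mem_A⟩ b
    change D.T₁ T ((w : D.V) * a * (H.antipode b : D.M₂) D.e₁) =
      D.T₁ T (D.e₁ * (w : D.V) * (b : D.M₂) a) at h
    rw [h, mul_assoc, D.T₁_jones_mul hMarkov, smul_smul, inv_mul_cancel₀ D.lam_ne_zero, one_smul]
  have hleft : ∀ a, (∀ b, D.pairing T w a b = 0) → a = 0 := fun a h =>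
    H.pairing_left a fun b => by rw [← hpair, h]
  have hright : ∀ b, (∀ a, D.pairing T w a b = 0) → b = 0 := fun b h =>
    H.pairing_right b fun a => by rw [← hpair, h]
  -- Nondegeneracy of the primed pairing is carried over from the first one along the bijection `S`.
  have hright' : ∀ b, (∀ a, D.pairing' T w a b = 0) → b = 0 := fun b hb => by
    obtain ⟨b, rfl⟩ := H.antipode_bijective.2 b
    rw [hright b fun a => by rw [← hS, hb], map_zero]
  refine ⟨f, fun f' => ⟨fun hf' => hf'.unique hf, fun h => h ▸ hf⟩, w, hw₁,
    Subalgebra.mem_center_iff.2 fun v => (hw₂ v).symm, hw₃, ⟨hleft, hright⟩,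
    ⟨fun a ha => hleft a fun b => by rw [← hS, ha], hright'⟩, H.weakHopfAlgebra,
    fun Δ ε S => ⟨fun h => ⟨?_, ?_, ?_⟩, ?_⟩, H.antipode_bijective, H.isSemisimpleRing⟩
  · refine LinearMap.ext fun b => H.pair₂_ext fun x y => ?_
    have h₁ := h.comul x y b
    rw [hpair', hpair', hpair'] at h₁
    exact h₁.trans (H.pair₂_comul x y b).symm
  · exact LinearMap.ext fun b => (h.counit b).trans (hpair 1 b)
  · refine LinearMap.ext fun b => sub_eq_zero.1 (hright' _ fun a => ?_)
    rw [map_sub, h.antipode]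
    exact sub_eq_zero.2 (hS a b).symm
  · rintro ⟨rfl, rfl, rfl⟩
    refine ⟨fun x y b => ?_, fun b => (hpair 1 b).symm, hS⟩
    rw [hpair', hpair', hpair']
    exact H.pair₂_comul x y b
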